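/- Let $\alpha=(\alpha_1,\alpha_2)$ with $\alpha_1,\alpha_2\in\mathbb{Q}\cap(0,1)$, let $d$ be the smallest common denominator of $\alpha_1,\alpha_2$, and let $p$ be a prime number not dividing $d$. Let $m$ be the denominator of $\alpha_1+\alpha_2$ (written as an irreducible fraction). Notation. ${}_2F_1(\alpha,(1);x)=\sum_{n\ge 0}\frac{(\alpha_1)_n(\alpha_2)_n}{(n!)^2}x^n$. For $\gamma\in\mathbb{Z}_{(p)}$, $\mathfrak{D}_p(\gamma)$ is the unique element of $\mathbb{Z}_{(p)}$ with $p\,\mathfrak{D}_p(\gamma)-\gamma\in\{0,1,\dots,p-1\}$; it is applied to $\alpha$ componentwise. $\ell_p$ is the smallest positive integer $\ell$ with $\{\mathfrak{D}_p^{\ell}(\alpha_1),\mathfrak{D}_p^{\ell}(\alpha_2)\}\equiv\{\alpha_1,\alpha_2\}\pmod{\mathbb{Z}}$ as sets, and $e_p=\ell_p/2$ when $\ell_p$ is even. $D$ is the subgroup of those $\lambda\in(\mathbb{Z}/d\mathbb{Z})^\times$ with $\{\lambda\alpha_1,\lambda\alpha_2\}\equiv\{\alpha_1,\alpha_2\}\pmod{\mathbb{Z}}$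 as sets, and $K$ is the subfield of $\mathbb{Q}(\zeta_d)$ fixed by $D$, where $\lambda\in(\mathbb{Z}/d\mathbb{Z})^\times$ acts by $\zeta_d\mapsto\zeta_d^{\lambda}$. For $k\ge 0$, $B_k(x)\in\mathbb{F}_p[x]$ is the truncation at $x^p$ of ${}_2F_1(\mathfrak{D}_p^k(\alpha),(1);x)\bmod p$, and $$A(x)=\prod_{k=0}^{\ell_p-1}B_k(x)^{p^k}.$$ For a field $F$ and an element $a$ separable algebraic over $F$, $\mathrm{Gal}(a\mid F)$ is the Galois group over $F$ of the extension generated by $a$ and its conjugates. The series ${}_2F_1(\mathfrak{D}_p^k(\alpha),(1);x)$, $k\ge0$, have coefficients in $\mathbb{Z}_{(p)}$, and the following hold. (1) Assume that $\ell_p$ is even and that $-p^{e_p}\in D$. Then $(1+p^{e_p})(1-\alpha_1-\alpha_2)$ is an integer, and in $\mathbb{F}_p(x)$ $$A(x)=(1-x)^{(1+p^{e_p})(1-\alpha_1-\alpha_2)}\left(B_{e_p}(x)\,B_{e_p+1}(x)^{p}\cdots B_{\ell_p-1}(x)^{p^{e_p-1}}\right)^{1+p^{e_p}}.$$ Moreover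 $m$ divides $1+p^{e_p}$, and $A(x)$ is the $\frac{1+p^{e_p}}{m}$-th power of a polynomial in $\mathbb{F}_p[x]$. (2) Let $\mathfrak{p}$ be a prime of $K$ above $p$, with residue field $k_{\mathfrak{p}}$. Then ${}_2F_1(\alpha,(1);x)\bmod p$, viewed in $k_{\mathfrak{p}}((x))$, is separable algebraic over $k_{\mathfrak{p}}(x)$, and the group $\mathrm{Gal}({}_2F_1(\alpha,(1);x)\mid k_{\mathfrak{p}}(x))$ embeds in $k_{\mathfrak{p}}^{\times}$ and hence is cyclic. If moreover $\ell_p$ is even and $-p^{e_p}\in D$, then its order divides $(p^{e_p}-1)\cdot m$. -/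

import Mathlib

open scoped Polynomial PowerSeries NumberField

namespace GaussHyp

/-! ### Rational parameters modulo the integers -/

/-- The set of classes modulo `ℤ` of a family of rational parameters. -/
def classes {ι : Type*} (γ : ι → ℚ) : Set (AddCircle (1 : ℚ)) :=
  Set.range fun i => (γ i : AddCircle (1 : ℚ))

/-- The smallest common denominator `d` of two families of parameters. -/
def commonDenom {ι κ : Type*} [Fintype ι] [Fintype κ] (α : ι → ℚ) (β : κ → ℚ) : ℕ :=
  Nat.lcm (Finset.univ.lcm fun i => (α i).den) (Finset.univ.lcm fun j => (β j).den)

section Helpers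

variable {ι κ : Type*} [Fintype ι] [Fintype κ] (α : ι → ℚ) (β : κ → ℚ)

theorem commonDenom_ne_zero : commonDenom α β ≠ 0 := by
  have h1 : (Finset.univ.lcm fun i => (α i).den) ≠ 0 := by
    intro h
    rw [Finset.lcm_eq_zero_iff] at h
    obtain ⟨i, -, hi⟩ := h
    exact (α i).den_nz hi
  have h2 : (Finset.univ.lcm fun j => (β j).den) ≠ 0 := by
    intro h
    rw [Finset.lcm_eq_zero_iff] at h
    obtain ⟨j, -, hj⟩ := h
    exact (β j).den_nz hj
  exact Nat.lcm_ne_zero h1 h2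

instance commonDenom_neZero : NeZero (commonDenom α β) := ⟨commonDenom_ne_zero α β⟩

theorem nsmul_class_eq_zero {d : ℕ} {a : ℚ} (h : a.den ∣ d) :
    d • (a : AddCircle (1 : ℚ)) = 0 := by
  obtain ⟨c, rfl⟩ := h
  rw [← AddCircle.coe_nsmul, AddCircle.coe_eq_zero_iff]
  refine ⟨c * a.num, ?_⟩
  have h := Rat.den_mul_eq_num a
  simp only [zsmul_eq_mul, nsmul_eq_mul, mul_one]
  push_cast
  rw [← h]
  ring

theorem val_mul_nsmul {d : ℕ} {x : AddCircle (1 : ℚ)} (hx : d • x = 0) (a b : ZMod d) :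
    (a * b).val • x = a.val • (b.val • x) := by
  have hd : ((a * b).val) = (a.val * b.val) % d := ZMod.val_mul a b
  rw [hd, ← mul_nsmul']
  conv_rhs => rw [← Nat.mod_add_div (a.val * b.val) d]
  rw [add_nsmul, mul_nsmul, hx, nsmul_zero, add_zero]

theorem val_one_nsmul {d : ℕ} {x : AddCircle (1 : ℚ)} (hx : d • x = 0) :
    (1 : ZMod d).val • x = x := by
  rcases Nat.lt_trichotomy d 1 with h | h | h
  · obtain rfl : d = 0 := by omega
    exact one_nsmul x
  · subst h
    rw [one_nsmul] at hx
    simp [hx]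
  · have : Fact (1 < d) := ⟨h⟩
    rw [ZMod.val_one, one_nsmul]

end Helpers

/-- The family `lam • γ` (its classes modulo `ℤ` depend only on `lam` modulo `d` as soon as
`γ` has values in `d⁻¹ ℤ`). -/
def scale {ι : Type*} {d : ℕ} (lam : (ZMod d)ˣ) (γ : ι → ℚ) : ι → ℚ :=
  fun i => ((lam : ZMod d).val : ℚ) * γ i

theorem classes_scale {ι : Type*} {d : ℕ} (lam : (ZMod d)ˣ) (γ : ι → ℚ) :
    classes (scale lam γ) = (fun x => (lam : ZMod d).val • x) '' classes γ := by
  unfold classes scale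
  rw [← Set.range_comp]
  congr 1

theorem nsmul_eq_zero_of_mem_classes {ι : Type*} {d : ℕ} {γ : ι → ℚ}
    (h : ∀ i, (γ i).den ∣ d) {x : AddCircle (1 : ℚ)} (hx : x ∈ classes γ) : d • x = 0 := by
  obtain ⟨i, rfl⟩ := hx
  exact nsmul_class_eq_zero (h i)

/-- For a family with denominators dividing `d`, the units of `ℤ/dℤ` that permute its classes
modulo `ℤ` (equality is equality of sets). -/
def unitStabilizer {ι : Type*} (d : ℕ) (γ : ι → ℚ) (h : ∀ i, (γ i).den ∣ d) :
    Subgroup (ZMod d)ˣ where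
  carrier := {lam | classes (scale lam γ) = classes γ}
  one_mem' := by
    simp only [Set.mem_ofPred_eq, classes_scale, Units.val_one]
    ext x
    constructor
    · rintro ⟨y, hy, rfl⟩
      simpa only [val_one_nsmul (nsmul_eq_zero_of_mem_classes h hy)] using hy
    · intro hx
      exact ⟨x, hx, val_one_nsmul (nsmul_eq_zero_of_mem_classes h hx)⟩
  mul_mem' := by
    intro a b ha hb
    simp only [Set.mem_ofPred_eq, classes_scale, Units.val_mul] at *
    conv_rhs => rw [← ha]; arg 2; rw [← hb]
    rw [Set.image_image]
    apply Set.image_congr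
    intro x hx
    exact val_mul_nsmul (nsmul_eq_zero_of_mem_classes h hx) _ _
  inv_mem' := by
    intro a ha
    simp only [Set.mem_ofPred_eq, classes_scale] at *
    conv_lhs => rw [← ha]
    rw [Set.image_image]
    ext x
    constructor
    · rintro ⟨y, hy, rfl⟩
      have hy0 := nsmul_eq_zero_of_mem_classes h hy
      simp only
      rw [← val_mul_nsmul hy0, Units.inv_mul, val_one_nsmul hy0]
      exact hy
    · intro hx
      have hx0 := nsmul_eq_zero_of_mem_classes h hx
      refine ⟨x, hx, ?_⟩
      simp only
      rw [← val_mul_nsmul hx0, Units.inv_mul, val_one_nsmul hx0]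

/-- The group `D(α, β)` of the `lam ∈ (ℤ/dℤ)ˣ` such that `lam • α ≡ α` and `lam • β ≡ β`
modulo `ℤ` as sets, where `d` is the common denominator of the parameters. -/
def groupD {ι κ : Type*} [Fintype ι] [Fintype κ] (α : ι → ℚ) (β : κ → ℚ) :
    Subgroup (ZMod (commonDenom α β))ˣ :=
  unitStabilizer (commonDenom α β) α
      (fun i => (Finset.dvd_lcm (Finset.mem_univ i)).trans (Nat.dvd_lcm_left _ _)) ⊓
    unitStabilizer (commonDenom α β) β
      (fun j => (Finset.dvd_lcm (Finset.mem_univ j)).trans (Nat.dvd_lcm_right _ _))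

/-- The number field `K(α, β)`: the subfield of the `d`-th cyclotomic field `L = ℚ(ζ_d)` fixed by
`D(α, β)`, where `lam ∈ (ℤ/dℤ)ˣ` acts by `ζ_d ↦ ζ_d ^ lam`. -/
noncomputable def fieldK {ι κ : Type*} [Fintype ι] [Fintype κ] (α : ι → ℚ) (β : κ → ℚ)
    (L : Type*) [Field L] [CharZero L] [IsCyclotomicExtension {commonDenom α β} ℚ L] :
    IntermediateField ℚ L :=
  IntermediateField.fixedField
    ((groupD α β).comap
      (IsCyclotomicExtension.autEquivPow L (Polynomial.cyclotomic.irreducible_rat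
        (Nat.pos_of_ne_zero (commonDenom_ne_zero α β)))).toMonoidHom)

/-! ### The Dwork map -/

/-- The Dwork map: for `γ` with denominator prime to `p`, the unique rational number `δ` with
denominator prime to `p` such that `p * δ - γ ∈ {0, …, p - 1}`. Here the remainder
`p * δ - γ` is the representative of `-γ mod p` in `{0, …, p - 1}`. -/
noncomputable def dwork (p : ℕ) [Fact p.Prime] (γ : ℚ) : ℚ :=
  (γ + ((-(γ : ZMod p)).val : ℚ)) / p

/-- The `k`-th iterate of the Dwork map, applied to all the members of a family. -/
noncomputable def dworkIter (p : ℕ) [Fact p.Prime] {ι : Type*} (k : ℕ) (γ : ι → ℚ) : ι → ℚ :=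
  fun i => (dwork p)^[k] (γ i)

/-- The integer `ℓ_p(α, β)`: the smallest positive `ℓ` such that the `ℓ`-th iterate of the Dwork
map preserves `α` and `β` modulo `ℤ` as sets. -/
noncomputable def dworkOrder (p : ℕ) [Fact p.Prime] {ι κ : Type*} (α : ι → ℚ) (β : κ → ℚ) : ℕ :=
  sInf {l : ℕ | 0 < l ∧ classes (dworkIter p l α) = classes α ∧
    classes (dworkIter p l β) = classes β}

/-! ### Reductions of Gaussian hypergeometric series with bottom parameter `1` -/

/-- The coefficient of `x ^ n` in `₂F₁(α, (1); x) ∈ ℚ⟦x⟧`. -/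
noncomputable def hypCoeff (α : Fin 2 → ℚ) (n : ℕ) : ℚ :=
  ordinaryHypergeometricCoefficient (α 0) (α 1) 1 n

/-- The series `₂F₁(α, (1); x) mod p` with coefficients in a field `F` of characteristic `p`.
A rational number `a / b` with `b` prime to `p` is sent to `a / b` in `F`, that is, to its image
under `ℤ_(p) → 𝔽_p → F`. -/
noncomputable def hypMod (F : Type*) [Field F] (α : Fin 2 → ℚ) : F⟦X⟧ :=
  PowerSeries.mk fun n => (hypCoeff α n : F)

/-- The series `₂F₁(α, (1); x) mod p`, seen in the field `F((x))`. -/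
noncomputable def hypLaurent (F : Type*) [Field F] (α : Fin 2 → ℚ) : LaurentSeries F :=
  HahnSeries.ofPowerSeries ℤ F (hypMod F α)

/-- `B_k(x) ∈ 𝔽_p[x]`: the truncation at `x ^ p` of the reduction modulo `p` of
`₂F₁(𝔇_p^k(α), (1); x)`. -/
noncomputable def polyB (p : ℕ) [Fact p.Prime] (α : Fin 2 → ℚ) (k : ℕ) : (ZMod p)[X] :=
  PowerSeries.trunc p (hypMod (ZMod p) (dworkIter p k α))

/-- `A(x) = B_0(x) B_1(x)^p ⋯ B_{ℓ-1}(x)^(p^(ℓ-1)) ∈ 𝔽_p[x]` where `ℓ = ℓ_p(α, (1))`. -/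
noncomputable def polyA (p : ℕ) [Fact p.Prime] (α : Fin 2 → ℚ) : (ZMod p)[X] :=
  ∏ k ∈ Finset.range (dworkOrder p α ![1]), polyB p α k ^ p ^ k

/-- The inclusion of `F(x)` in `F((x))`. -/
noncomputable instance ratFuncLaurentAlgebra (F : Type*) [Field F] :
    Algebra (RatFunc F) (LaurentSeries F) :=
  RatFunc.liftAlgebra F (LaurentSeries F)

/-- `Gal(a | F)`: the Galois group over `F` of the extension generated by the conjugates of `a`,
that is, of the splitting field of the minimal polynomial of `a`. -/
abbrev GalOf (F : Type*) {E : Type*} [Field F] [Field E] [Algebra F E] (a : E) : Type _ :=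
  (minpoly F a).Gal

end GaussHyp

/-! Write `f_α` for `₂F₁(α, (1); x)` mod `p` and `𝔇` for the Dwork map. Since `(a)_n / n! = (-1)^n *
choose (-a) n` and `-a = r + p * (-𝔇 a)` with `0 ≤ r < p`, Lucas' congruence over `ℤ_[p]` gives `f_α
= B_0 * f_{𝔇α} ^ p` (`hypMod_eq_trunc_mul_pow`). Modulo `ℤ`, `𝔇` is division by `p`, and it
preserves `(0, 1)`; hence `α` returns to itself, up to order, after `ℓ = ℓ_p` steps, and `A * f_α ^
(p^ℓ - 1) = 1` (`mul_hypMod_pow_eq_one`).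

So `f_α` is a root of order `p^ℓ - 1`, prime to `p`, of a rational function: it is separable. A
Frobenius of `ℚ(ζ_d)/K` above `𝔭` raises `ζ_d` to the power `N𝔭 = p^f`, so `p^f ∈ D` and `ℓ ∣ f`
(`exists_card_quotient_eq_pow`). Thus `k_𝔭` contains the roots of unity of order `p^ℓ - 1`, and
Kummer theory applies (`exists_kummer_character`).

If `ℓ = 2e` and `-p^e ∈ D`, then `𝔇^e α = 1 - α` up to order, and Euler's transformation relates
`B_k` to `B_{e+k}` by a power of `1 - x` (`euler_transformation_trunc`); these powers telescope in
`A`. Since `m ∣ 1 + p^e`, this makes `A = g ^ M` with `M = (1 + p^e) / m`. Then `g * f_α ^ ((p^e -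
1) * m)` is an `M`-th root of unity, hence constant, so `f_α` is already a root of order `(p^e - 1)
* m` of a rational function. -/

namespace GaussHyp

/-! ### Lucas' and Dwork's congruences for coefficients. -/

section Padic

variable {p : ℕ} [hp : Fact p.Prime]

theorem toZMod_eq_zero_iff_norm_lt_one (z : ℤ_[p]) : PadicInt.toZMod z = 0 ↔ ‖z‖ < 1 := by
  rw [← RingHom.mem_ker, PadicInt.ker_toZMod, IsLocalRing.mem_maximalIdeal,
    PadicInt.mem_nonunits]

theorem isClosed_toZMod_eq_zero : IsClosed {z : ℤ_[p] | PadicInt.toZMod z = 0} := by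
  have : {z : ℤ_[p] | PadicInt.toZMod z = 0} = Metric.ball 0 1 := by
    ext z
    simp [toZMod_eq_zero_iff_norm_lt_one]
  rw [this]
  exact IsUltrametricDist.isClosed_ball _ _

/-- Lucas' congruence for binomial coefficients with a `p`-adic integer on top. -/
theorem toZMod_choose_add_mul (r n : ℕ) (hr : r < p) (y : ℤ_[p]) :
    PadicInt.toZMod (Ring.choose ((r : ℤ_[p]) + (p : ℤ_[p]) * y) n) =
      (r.choose (n % p) : ZMod p) * PadicInt.toZMod (Ring.choose y (n / p)) := by
  have hcl : IsClosed {y : ℤ_[p] | PadicInt.toZMod (Ring.choose ((r : ℤ_[p]) + p * y) n -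
      (r.choose (n % p) : ℤ_[p]) * Ring.choose y (n / p)) = 0} := by
    refine isClosed_toZMod_eq_zero.preimage ?_
    have h1 := PadicInt.continuous_choose (p := p) n
    have h2 := PadicInt.continuous_choose (p := p) (n / p)
    exact (h1.comp (by fun_prop : Continuous fun y : ℤ_[p] => (r : ℤ_[p]) + p * y)).sub
      (continuous_const.mul h2)
  have key : ∀ y : ℤ_[p], PadicInt.toZMod (Ring.choose ((r : ℤ_[p]) + p * y) n -
      (r.choose (n % p) : ℤ_[p]) * Ring.choose y (n / p)) = 0 := by
    intro y
    -- Both sides are continuous in `y` and congruence modulo `p` is a closed condition, so density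
    -- of `ℕ` in `ℤ_[p]` reduces to the classical Lucas congruence.
    refine PadicInt.denseRange_natCast.induction_on (p := fun y : ℤ_[p] => PadicInt.toZMod
      (Ring.choose ((r : ℤ_[p]) + p * y) n - (r.choose (n % p) : ℤ_[p]) *
        Ring.choose y (n / p)) = 0) y hcl ?_
    intro N
    have h1 : ((r : ℤ_[p]) + p * (N : ℤ_[p])) = ((r + p * N : ℕ) : ℤ_[p]) := by push_cast; ring
    rw [h1, Ring.choose_natCast, Ring.choose_natCast, map_sub, map_mul, map_natCast, map_natCast,
      map_natCast, sub_eq_zero]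
    have h2 := Choose.choose_modEq_choose_mod_mul_choose_div_nat (n := r + p * N) (k := n) (p := p)
    rw [Nat.add_mul_mod_self_left, Nat.mod_eq_of_lt hr, Nat.add_mul_div_left _ _ hp.out.pos,
      Nat.div_eq_of_lt hr, zero_add] at h2
    have h3 := (ZMod.natCast_eq_natCast_iff _ _ _).2 h2
    simpa using h3
  have := key y
  rwa [map_sub, map_mul, map_natCast, sub_eq_zero] at this

theorem exists_padicInt_of_not_dvd_den {q : ℚ} (hq : ¬ p ∣ q.den) :
    ∃ z : ℤ_[p], (z : ℚ_[p]) = (q : ℚ_[p]) :=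
  ⟨⟨q, Padic.norm_rat_le_one hq⟩, rfl⟩

theorem not_dvd_den_of_padicInt {q : ℚ} {z : ℤ_[p]} (h : (z : ℚ_[p]) = (q : ℚ_[p])) :
    ¬ p ∣ q.den := by
  have h1 : ‖(q : ℚ_[p])‖ ≤ 1 := h ▸ z.2
  have h2 := PadicInt.isUnit_den q h1
  rw [PadicInt.isUnit_iff] at h2
  intro h3
  have := (PadicInt.norm_int_lt_one_iff_dvd (p := p) (q.den : ℤ)).2 (by exact_mod_cast h3)
  rw [Int.cast_natCast, h2] at this
  exact lt_irrefl _ this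

theorem ratCast_zmod_eq_toZMod {q : ℚ} {z : ℤ_[p]} (h : (z : ℚ_[p]) = (q : ℚ_[p])) :
    (q : ZMod p) = PadicInt.toZMod z := by
  have hd := not_dvd_den_of_padicInt h
  have hd' : (q.den : ZMod p) ≠ 0 := by rwa [Ne, ZMod.natCast_eq_zero_iff]
  have h1 : z * (q.den : ℤ_[p]) = (q.num : ℤ_[p]) := by
    apply PadicInt.ext
    push_cast
    rw [h]
    exact_mod_cast Rat.mul_den_eq_num q
  have h2 := congrArg PadicInt.toZMod h1
  rw [map_mul, map_natCast, map_intCast] at h2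
  rw [Rat.cast_def, ← h2, mul_div_cancel_right₀ _ hd']

/-- The Dwork map on `p`-adic integers. -/
theorem exists_padicInt_dwork {q : ℚ} {z : ℤ_[p]} (h : (z : ℚ_[p]) = (q : ℚ_[p])) :
    ∃ w : ℤ_[p], (w : ℚ_[p]) = (dwork p q : ℚ_[p]) ∧
      (p : ℤ_[p]) * w = z + ((-(q : ZMod p)).val : ℤ_[p]) := by
  have h0 : PadicInt.toZMod (z + ((-(q : ZMod p)).val : ℤ_[p])) = 0 := by
    rw [map_add, map_natCast, ZMod.natCast_val, ZMod.cast_id, ratCast_zmod_eq_toZMod h]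
    simp
  rw [← RingHom.mem_ker, PadicInt.ker_toZMod, PadicInt.maximalIdeal_eq_span_p,
    Ideal.mem_span_singleton] at h0
  obtain ⟨w, hw⟩ := h0
  refine ⟨w, ?_, hw.symm⟩
  have h1 := congrArg ((↑) : ℤ_[p] → ℚ_[p]) hw
  have hp0 : (p : ℚ_[p]) ≠ 0 := by exact_mod_cast hp.out.ne_zero
  push_cast at h1
  rw [dwork]
  push_cast
  rw [← h, eq_div_iff hp0, h1, mul_comm]

/-- From `(a)_n / n! = (-1)^n * choose (-a) n`, the two signs cancelling. It yields both the
integrality of the coefficients and access to Lucas' congruence. -/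
theorem hypCoeff_eq_choose {α : Fin 2 → ℚ} {x y : ℤ_[p]} (hx : (x : ℚ_[p]) = (α 0 : ℚ_[p]))
    (hy : (y : ℚ_[p]) = (α 1 : ℚ_[p])) (n : ℕ) :
    ((Ring.choose (-x) n * Ring.choose (-y) n : ℤ_[p]) : ℚ_[p]) = (hypCoeff α n : ℚ_[p]) := by
  have key : ∀ (z : ℤ_[p]) (q : ℚ), (z : ℚ_[p]) = (q : ℚ_[p]) →
      (n.factorial : ℚ_[p]) * ((Ring.choose (-z) n : ℤ_[p]) : ℚ_[p]) =
        (-1) ^ n * (((ascPochhammer ℚ n).eval q : ℚ) : ℚ_[p]) := by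
    intro z q hz
    have h1 : (ascPochhammer ℤ_[p] n).eval z = (n.factorial : ℤ_[p]) * Ring.multichoose z n := by
      rw [← nsmul_eq_mul, Ring.factorial_nsmul_multichoose_eq_ascPochhammer,
        Polynomial.ascPochhammer_smeval_eq_eval]
    have h2 : Ring.choose (-z) n = (-1) ^ n * Ring.multichoose z n := by
      rw [Ring.choose_neg, Ring.multichoose_eq, Int.negOnePow_def]
      simp [Units.smul_def]
    have h3 : (((ascPochhammer ℤ_[p] n).eval z : ℤ_[p]) : ℚ_[p]) =
        (((ascPochhammer ℚ n).eval q : ℚ) : ℚ_[p]) := by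
      have e1 := Polynomial.eval_map_apply (PadicInt.Coe.ringHom (p := p)) z
        (p := ascPochhammer ℤ_[p] n)
      have e2 := Polynomial.eval_map_apply (Rat.castHom ℚ_[p]) q (p := ascPochhammer ℚ n)
      rw [ascPochhammer_map] at e1 e2
      rw [show (PadicInt.Coe.ringHom z : ℚ_[p]) = Rat.castHom ℚ_[p] q from hz, e2] at e1
      exact e1.symm
    rw [h2, ← h3, h1]
    push_cast
    ring
  have hn : (n.factorial : ℚ_[p]) ≠ 0 := by exact_mod_cast n.factorial_ne_zero
  have hx' := key x _ hx
  have hy' := key y _ hy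
  rw [hypCoeff]
  simp only [ordinaryHypergeometricCoefficient, ascPochhammer_eval_one]
  push_cast
  have hs : ((-1 : ℚ_[p]) ^ n) * (-1) ^ n = 1 := by rw [← mul_pow]; simp
  field_simp
  linear_combination (n.factorial * ((Ring.choose (-y) n : ℤ_[p]) : ℚ_[p])) * hx' +
    ((-1) ^ n * (((ascPochhammer ℚ n).eval (α 0) : ℚ) : ℚ_[p])) * hy' +
    (((ascPochhammer ℚ n).eval (α 0) : ℚ) : ℚ_[p]) *
    (((ascPochhammer ℚ n).eval (α 1) : ℚ) : ℚ_[p]) * hs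

theorem not_dvd_den_hypCoeff {α : Fin 2 → ℚ} (h : ∀ i, ¬ p ∣ (α i).den) (n : ℕ) :
    ¬ p ∣ (hypCoeff α n).den := by
  obtain ⟨x, hx⟩ := exists_padicInt_of_not_dvd_den (h 0)
  obtain ⟨y, hy⟩ := exists_padicInt_of_not_dvd_den (h 1)
  exact not_dvd_den_of_padicInt (hypCoeff_eq_choose hx hy n)

theorem not_dvd_den_dwork {q : ℚ} (h : ¬ p ∣ q.den) : ¬ p ∣ (dwork p q).den := by
  obtain ⟨x, hx⟩ := exists_padicInt_of_not_dvd_den h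
  obtain ⟨w, hw, -⟩ := exists_padicInt_dwork hx
  exact not_dvd_den_of_padicInt hw

theorem not_dvd_den_dwork_iterate {q : ℚ} (h : ¬ p ∣ q.den) (k : ℕ) :
    ¬ p ∣ ((dwork p)^[k] q).den := by
  induction k with
  | zero => exact h
  | succ k ih => rw [Function.iterate_succ_apply']; exact not_dvd_den_dwork ih

/-- Dwork's congruence modulo `p` for the coefficients of `₂F₁(α, (1); x)`. -/
theorem hypCoeff_zmod {α : Fin 2 → ℚ} (h : ∀ i, ¬ p ∣ (α i).den) (n : ℕ) :
    (hypCoeff α n : ZMod p) = ((-(α 0 : ZMod p)).val.choose (n % p) : ZMod p) *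
      ((-(α 1 : ZMod p)).val.choose (n % p) : ZMod p) *
        (hypCoeff (fun i => dwork p (α i)) (n / p) : ZMod p) := by
  obtain ⟨x, hx⟩ := exists_padicInt_of_not_dvd_den (h 0)
  obtain ⟨y, hy⟩ := exists_padicInt_of_not_dvd_den (h 1)
  obtain ⟨x', hx', ex⟩ := exists_padicInt_dwork hx
  obtain ⟨y', hy', ey⟩ := exists_padicInt_dwork hy
  rw [ratCast_zmod_eq_toZMod (hypCoeff_eq_choose hx hy n),
    ratCast_zmod_eq_toZMod (hypCoeff_eq_choose (α := fun i => dwork p (α i)) hx' hy' (n / p)),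
    map_mul, map_mul]
  have e1 : -x = (((-(α 0 : ZMod p)).val : ℕ) : ℤ_[p]) + p * (-x') := by linear_combination ex
  have e2 : -y = (((-(α 1 : ZMod p)).val : ℕ) : ℤ_[p]) + p * (-y') := by linear_combination ey
  rw [e1, e2, toZMod_choose_add_mul _ _ (ZMod.val_lt _), toZMod_choose_add_mul _ _ (ZMod.val_lt _)]
  ring

end Padic

/-! ### Euler's transformation at natural numbers, over any commutative ring. -/

section Euler

theorem add_choose_eq_sum_range (s n : ℕ) :
    (s + n).choose s = ∑ j ∈ Finset.range (s + 1), s.choose j * n.choose j := by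
  rw [Nat.add_choose_eq, Finset.Nat.sum_antidiagonal_eq_sum_range_succ_mk,
    ← Finset.sum_range_reflect]
  refine Finset.sum_congr rfl fun j hj => ?_
  have hj : j ≤ s := by simpa [Nat.lt_succ_iff] using hj
  have e : s + 1 - 1 - j = s - j := by omega
  simp only [e, Nat.choose_symm hj, Nat.sub_sub_self hj]

variable {R : Type*} [CommRing R]

/-- Trinomial revision extracts `choose s i * x ^ i`; what remains is the expansion of `(x + (1 -
x)) ^ (s - i) = 1`. -/
theorem sum_choose_mul_choose_mul_pow (x : R) (s i : ℕ) :
    ∑ j ∈ Finset.range (s + 1), (s.choose j * j.choose i : ℕ) * (x ^ j * (1 - x) ^ (s - j)) =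
      (s.choose i : R) * x ^ i := by
  rcases lt_or_ge s i with h | h
  · rw [Nat.choose_eq_zero_of_lt h, Nat.cast_zero, zero_mul]
    refine Finset.sum_eq_zero fun j hj => ?_
    have hj : j < s + 1 := by simpa using hj
    rw [Nat.choose_eq_zero_of_lt (by omega : j < i)]
    simp
  · obtain ⟨t, rfl⟩ := Nat.exists_eq_add_of_le h
    rw [add_assoc, Finset.sum_range_add, Finset.sum_eq_zero, zero_add]
    · have h1 := add_pow x (1 - x) t
      rw [add_sub_cancel, one_pow] at h1
      conv_rhs => rw [← mul_one ((_ : R) * _), h1, Finset.mul_sum]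
      refine Finset.sum_congr rfl fun j hj => ?_
      have hj : j < t + 1 := by simpa using hj
      rw [Nat.choose_mul (by omega : i ≤ i + j), show i + t - i = t by omega,
        show i + j - i = j by omega, show i + t - (i + j) = t - j by omega, pow_add]
      push_cast
      ring
    · intro j hj
      have hj : j < i := by simpa using hj
      rw [Nat.choose_eq_zero_of_lt hj]
      simp

/-- Trinomial revision turns the coefficient into `choose (r + j) j * choose (r + n) (r + j)`, a
shifted coefficient of `(1 - X) ^ (-(r + j + 1))`. -/
theorem mk_choose_mul_choose_mul_one_sub_pow (r j : ℕ) :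
    (PowerSeries.mk fun n => (((r + n).choose r * n.choose j : ℕ) : R)) *
      (1 - PowerSeries.X) ^ (r + j + 1) =
      ((r + j).choose j : R⟦X⟧) * PowerSeries.X ^ j := by
  have h1 : (PowerSeries.mk fun n => (((r + n).choose r * n.choose j : ℕ) : R)) =
      ((r + j).choose j : R⟦X⟧) * PowerSeries.X ^ j *
        PowerSeries.mk fun n => (((r + j + n).choose (r + j) : ℕ) : R) := by
    ext n
    rw [mul_right_comm, PowerSeries.coeff_mul_X_pow', PowerSeries.coeff_mk]
    split_ifs with h
    · obtain ⟨i, rfl⟩ := Nat.exists_eq_add_of_le h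
      rw [← map_natCast (PowerSeries.C (R := R)), PowerSeries.coeff_C_mul, PowerSeries.coeff_mk,
        ← Nat.cast_mul, Nat.add_sub_cancel_left]
      congr 1
      have h2 := Nat.choose_mul (n := r + (j + i)) (k := r + j) (s := r) (by omega)
      rw [show r + (j + i) - r = j + i by omega, show r + j - r = j by omega] at h2
      rw [← h2, ← Nat.choose_symm_add (a := r) (b := j), add_assoc, mul_comm]
    · rw [Nat.choose_eq_zero_of_lt (Nat.lt_of_not_le h), mul_zero, Nat.cast_zero]
  rw [h1, mul_assoc, PowerSeries.mk_add_choose_mul_one_sub_pow_eq_one, mul_one]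

/-- Euler's transformation of `₂F₁(-r, -s; 1; x)` for natural numbers `r` and `s`. -/
theorem euler_transformation_natCast (r s : ℕ) :
    (PowerSeries.mk fun n => (((r + n).choose r * (s + n).choose s : ℕ) : R)) *
      (1 - PowerSeries.X) ^ (r + s + 1) =
      ∑ i ∈ Finset.range (r + 1), ((r.choose i * s.choose i : ℕ) : R⟦X⟧) * PowerSeries.X ^ i := by
  have h1 : (PowerSeries.mk fun n => (((r + n).choose r * (s + n).choose s : ℕ) : R)) =
      ∑ j ∈ Finset.range (s + 1), (s.choose j : R⟦X⟧) *
        PowerSeries.mk fun n => (((r + n).choose r * n.choose j : ℕ) : R) := by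
    ext n
    rw [map_sum]
    simp_rw [← map_natCast (PowerSeries.C (R := R)), PowerSeries.coeff_C_mul, PowerSeries.coeff_mk]
    rw [add_choose_eq_sum_range s n, Finset.mul_sum, Nat.cast_sum]
    refine Finset.sum_congr rfl fun j _ => ?_
    push_cast
    ring
  -- The `j`-th term uses up `r + j + 1` factors `1 - X` and leaves `s - j`. A second Vandermonde
  -- expansion, of `choose (r + j) r`, makes the sum over `j` collapse by
  -- `sum_choose_mul_choose_mul_pow`.
  have h2 : ∀ j ∈ Finset.range (s + 1), (s.choose j : R⟦X⟧) *
        (PowerSeries.mk fun n => (((r + n).choose r * n.choose j : ℕ) : R)) *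
          (1 - PowerSeries.X) ^ (r + s + 1) =
      ∑ i ∈ Finset.range (r + 1), (r.choose i : R⟦X⟧) * (((s.choose j * j.choose i : ℕ) : R⟦X⟧) *
        (PowerSeries.X ^ j * (1 - PowerSeries.X) ^ (s - j))) := by
    intro j hj
    have hj : j ≤ s := by simpa [Nat.lt_succ_iff] using hj
    have h3 := mk_choose_mul_choose_mul_one_sub_pow (R := R) r j
    have e : r + s + 1 = (r + j + 1) + (s - j) := by omega
    rw [e, pow_add, mul_assoc, ← mul_assoc (PowerSeries.mk _), h3, Nat.choose_symm_add.symm,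
      add_choose_eq_sum_range r j, Nat.cast_sum, Finset.sum_mul, Finset.sum_mul, Finset.mul_sum]
    refine Finset.sum_congr rfl fun i _ => ?_
    push_cast
    ring
  rw [h1, Finset.sum_mul, Finset.sum_congr rfl h2, Finset.sum_comm]
  refine Finset.sum_congr rfl fun i _ => ?_
  rw [← Finset.mul_sum, sum_choose_mul_choose_mul_pow]
  push_cast
  ring

end Euler

/-! ### Truncated series as polynomials modulo `p`. -/

section ModP

variable (p : ℕ) [hp : Fact p.Prime]

/-- The polynomial `₂F₁(-r, -s; 1; x)` modulo `p`, for natural numbers `r, s < p`. -/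
noncomputable def chooseMulPoly (r s : ℕ) : (ZMod p)[X] :=
  ∑ n ∈ Finset.range p, Polynomial.C ((r.choose n * s.choose n : ℕ) : ZMod p) * Polynomial.X ^ n

theorem coeff_chooseMulPoly (r s n : ℕ) : (chooseMulPoly p r s).coeff n =
    if n < p then ((r.choose n * s.choose n : ℕ) : ZMod p) else 0 := by
  simp only [chooseMulPoly, Polynomial.finsetSum_coeff, Polynomial.coeff_C_mul_X_pow]
  simp

variable {p}

/-- Multiplied by `n!`, invertible as `n < p`, the left side is a rising factorial at `r + 1`, and
`-(r + 1) = p - 1 - r` modulo `p`. -/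
theorem natCast_choose_add_eq (r n : ℕ) (hr : r < p) (hn : n < p) :
    ((r + n).choose r : ZMod p) = (-1) ^ n * ((p - 1 - r).choose n : ZMod p) := by
  have h1 : (n.factorial : ZMod p) ≠ 0 := by
    rw [Ne, ZMod.natCast_eq_zero_iff, hp.out.dvd_factorial]
    omega
  apply mul_left_cancel₀ h1
  have h2 : ((n.factorial * (r + n).choose r : ℕ) : ZMod p) =
      (ascPochhammer (ZMod p) n).eval ((r : ZMod p) + 1) := by
    rw [Nat.choose_symm_add, ← Nat.ascFactorial_eq_factorial_mul_choose, ← ascPochhammer_nat_eq_ascFactorial]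
    simp
  have h3 : ((n.factorial * (p - 1 - r).choose n : ℕ) : ZMod p) =
      (descPochhammer (ZMod p) n).eval (-((r : ZMod p) + 1)) := by
    rw [← Nat.descFactorial_eq_factorial_mul_choose, ← descPochhammer_eval_eq_descFactorial]
    congr 1
    rw [Nat.cast_sub (by omega), Nat.cast_sub (by omega)]
    simp
    ring
  have h4 := ascPochhammer_eval_neg_eq_descPochhammer _ (-((r : ZMod p) + 1)) n
  rw [neg_neg, ← h2, ← h3] at h4
  push_cast at h4
  rw [h4]
  ring

end ModP

/-! ### Euler's transformation and Dwork's congruence for series modulo `p`. -/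

section ModP

variable {p : ℕ} [hp : Fact p.Prime]

theorem expand_zmod_eq_pow (f : (ZMod p)⟦X⟧) : PowerSeries.expand p hp.out.ne_zero f = f ^ p := by
  have h := MvPowerSeries.map_frobenius_expand p hp.out.ne_zero (f := (f : MvPowerSeries Unit (ZMod p)))
  rw [ZMod.frobenius_zmod] at h
  rw [MvPowerSeries.map_id] at h
  exact h

theorem natCast_choose_add_periodic (r n : ℕ) (hr : r < p) :
    ((r + (n + p)).choose r : ZMod p) = ((r + n).choose r : ZMod p) := by
  have h1 := Choose.choose_modEq_choose_mod_mul_choose_div_nat (n := r + (n + p)) (k := r) (p := p)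
  have h2 := Choose.choose_modEq_choose_mod_mul_choose_div_nat (n := r + n) (k := r) (p := p)
  rw [← add_assoc, Nat.add_mod_right, Nat.div_eq_of_lt hr, Nat.choose_zero_right] at h1
  rw [Nat.div_eq_of_lt hr, Nat.choose_zero_right] at h2
  rw [← add_assoc]
  exact (ZMod.natCast_eq_natCast_iff _ _ _).2 (h1.trans h2.symm)

/-- In characteristic `p` the factor is `1 - X ^ p`, which cuts a `p`-periodic sequence down to its
first period. -/
theorem mk_choose_mul_one_sub_pow_char (r s : ℕ) (hr : r < p) (hs : s < p) :
    (PowerSeries.mk fun n => (((r + n).choose r * (s + n).choose s : ℕ) : ZMod p)) *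
      (1 - PowerSeries.X) ^ p = (chooseMulPoly p (p - 1 - r) (p - 1 - s) : (ZMod p)⟦X⟧) := by
  have : CharP (ZMod p)⟦X⟧ p := charP_of_injective_algebraMap
    (algebraMap (ZMod p) (ZMod p)⟦X⟧).injective p
  rw [sub_pow_char, one_pow]
  ext n
  rw [mul_sub, mul_one, map_sub, PowerSeries.coeff_mul_X_pow', Polynomial.coeff_coe,
    coeff_chooseMulPoly, PowerSeries.coeff_mk, PowerSeries.coeff_mk]
  by_cases h : n < p
  · rw [if_pos h, if_neg (by omega), sub_zero]
    push_cast
    rw [natCast_choose_add_eq r n hr h, natCast_choose_add_eq s n hs h]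
    have : ((-1 : ZMod p) ^ n) * (-1) ^ n = 1 := by rw [← mul_pow]; simp
    linear_combination ((p - 1 - r).choose n * (p - 1 - s).choose n : ZMod p) * this
  · rw [if_neg h, if_pos (by omega)]
    obtain ⟨m, rfl⟩ := Nat.exists_eq_add_of_le' (Nat.le_of_not_lt h)
    push_cast
    rw [natCast_choose_add_periodic r m hr, natCast_choose_add_periodic s m hs,
      Nat.add_sub_cancel, sub_self]

/-- Euler's transformation for the truncations modulo `p`. -/
theorem euler_transformation_chooseMulPoly (r s : ℕ) (hr : r < p) (hs : s < p) :
    (1 - Polynomial.X) ^ p * chooseMulPoly p r s =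
      (1 - Polynomial.X) ^ (r + s + 1) * chooseMulPoly p (p - 1 - r) (p - 1 - s) := by
  apply Polynomial.coe_injective
  have h1 := mk_choose_mul_one_sub_pow_char r s hr hs
  have h2 := euler_transformation_natCast (R := ZMod p) r s
  have h3 : (∑ i ∈ Finset.range (r + 1), ((r.choose i * s.choose i : ℕ) : (ZMod p)⟦X⟧) *
      PowerSeries.X ^ i) = (chooseMulPoly p r s : (ZMod p)⟦X⟧) := by
    ext n
    simp_rw [← map_natCast (PowerSeries.C (R := ZMod p))]
    rw [map_sum, Polynomial.coeff_coe, coeff_chooseMulPoly]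
    simp only [PowerSeries.coeff_C_mul, PowerSeries.coeff_X_pow, mul_ite, mul_one, mul_zero,
      Finset.sum_ite_eq, Finset.mem_range]
    split_ifs with h h' h'
    · rfl
    · omega
    · rw [Nat.choose_eq_zero_of_lt (by omega : r < n)]
      simp
    · rfl
  rw [h3] at h2
  push_cast
  -- Both sides are now the same series times `(1 - X) ^ p * (1 - X) ^ (r + s + 1)`.
  rw [← h1, ← h2]
  ring

theorem hypCoeff_zero (α : Fin 2 → ℚ) : hypCoeff α 0 = 1 := by
  simp [hypCoeff, ordinaryHypergeometricCoefficient]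

theorem trunc_hypMod {α : Fin 2 → ℚ} (h : ∀ i, ¬ p ∣ (α i).den) :
    PowerSeries.trunc p (hypMod (ZMod p) α) =
      chooseMulPoly p (-(α 0 : ZMod p)).val (-(α 1 : ZMod p)).val := by
  ext n
  rw [PowerSeries.coeff_trunc, coeff_chooseMulPoly, hypMod, PowerSeries.coeff_mk]
  split_ifs with hn
  · rw [hypCoeff_zmod h, Nat.mod_eq_of_lt hn, Nat.div_eq_of_lt hn, hypCoeff_zero]
    simp
  · rfl

/-- Dwork's congruence modulo `p` for the series `₂F₁(α, (1); x)`. -/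
theorem hypMod_eq_trunc_mul_pow {α : Fin 2 → ℚ} (h : ∀ i, ¬ p ∣ (α i).den) :
    hypMod (ZMod p) α = (PowerSeries.trunc p (hypMod (ZMod p) α) : (ZMod p)⟦X⟧) *
      hypMod (ZMod p) (fun i => dwork p (α i)) ^ p := by
  rw [← expand_zmod_eq_pow, trunc_hypMod h]
  ext n
  -- The truncation has degree below `p` and the other factor is a series in `X ^ p`, so only
  -- Euclidean division of `n` by `p` contributes.
  rw [PowerSeries.coeff_mul, Finset.sum_eq_single (n % p, p * (n / p))]
  · rw [PowerSeries.coeff_expand_mul, Polynomial.coeff_coe, coeff_chooseMulPoly,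
      if_pos (Nat.mod_lt _ hp.out.pos), hypMod, hypMod, PowerSeries.coeff_mk, PowerSeries.coeff_mk,
      hypCoeff_zmod h]
    push_cast
    ring
  · rintro ⟨i, j⟩ hij hne
    rw [Finset.HasAntidiagonal.mem_antidiagonal] at hij
    simp only at hij
    by_cases hj : p ∣ j
    · obtain ⟨k, rfl⟩ := hj
      rw [Polynomial.coeff_coe, coeff_chooseMulPoly, if_neg, zero_mul]
      intro hi
      apply hne
      rw [← hij, Nat.add_mul_mod_self_left, Nat.mod_eq_of_lt hi, Nat.add_mul_div_left _ _ hp.out.pos,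
        Nat.div_eq_of_lt hi, zero_add]
    · rw [PowerSeries.coeff_expand_of_not_dvd _ _ _ hj, mul_zero]
  · intro hn
    exact absurd (Finset.HasAntidiagonal.mem_antidiagonal.2 (Nat.mod_add_div n p)) hn

theorem dworkIter_succ {ι : Type*} (k : ℕ) (γ : ι → ℚ) :
    dworkIter p (k + 1) γ = fun i => dwork p (dworkIter p k γ i) := by
  funext i
  simp only [dworkIter, Function.iterate_succ_apply']

theorem dworkIter_zero {ι : Type*} (γ : ι → ℚ) : dworkIter p 0 γ = γ := rfl

theorem hypMod_eq_prod_mul_pow {α : Fin 2 → ℚ} (h : ∀ i, ¬ p ∣ (α i).den) (l : ℕ) :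
    hypMod (ZMod p) α = ((∏ k ∈ Finset.range l, polyB p α k ^ p ^ k : (ZMod p)[X]) : (ZMod p)⟦X⟧) *
      hypMod (ZMod p) (dworkIter p l α) ^ p ^ l := by
  induction l with
  | zero => simp [dworkIter_zero]
  | succ l ih =>
    have h1 := hypMod_eq_trunc_mul_pow (p := p) (α := dworkIter p l α)
      fun i => not_dvd_den_dwork_iterate (h i) l
    rw [← dworkIter_succ] at h1
    rw [ih, Finset.prod_range_succ, Polynomial.coe_mul, mul_assoc]
    congr 1
    conv_lhs => rw [h1]
    rw [mul_pow, Polynomial.coe_pow, ← pow_mul, pow_succ' p l]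
    rfl

theorem hypMod_map (F : Type*) [Field F] [Algebra (ZMod p) F] (α : Fin 2 → ℚ) :
    (hypMod (ZMod p) α).map (algebraMap (ZMod p) F) = hypMod F α := by
  ext n
  simp [hypMod]

end ModP

/-! ### The Dwork map modulo the integers, and `ℓ_p` as an order modulo `D`. -/

section Dwork

variable {p : ℕ} [hp : Fact p.Prime]

theorem mul_dwork (q : ℚ) : (p : ℚ) * dwork p q = q + ((-(q : ZMod p)).val : ℚ) := by
  have : (p : ℚ) ≠ 0 := by exact_mod_cast hp.out.ne_zero
  rw [dwork, mul_div_cancel₀ _ this]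

theorem dwork_mem_Ioo {q : ℚ} (h : 0 < q ∧ q < 1) : 0 < dwork p q ∧ dwork p q < 1 := by
  have hp0 : (0 : ℚ) < p := by exact_mod_cast hp.out.pos
  have h1 : ((-(q : ZMod p)).val : ℚ) + 1 ≤ p := by exact_mod_cast ZMod.val_lt (-(q : ZMod p))
  have h2 : (0 : ℚ) ≤ ((-(q : ZMod p)).val : ℚ) := by positivity
  rw [dwork, lt_div_iff₀ hp0, div_lt_iff₀ hp0]
  constructor <;> linarith [h.1, h.2]

theorem dwork_iterate_mem_Ioo {q : ℚ} (h : 0 < q ∧ q < 1) (k : ℕ) :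
    0 < (dwork p)^[k] q ∧ (dwork p)^[k] q < 1 := by
  induction k with
  | zero => exact h
  | succ k ih => rw [Function.iterate_succ_apply']; exact dwork_mem_Ioo ih

theorem ratCast_zmod_one_sub {q : ℚ} (h : ¬ p ∣ q.den) :
    ((1 - q : ℚ) : ZMod p) = 1 - (q : ZMod p) := by
  have hq : (q.den : ZMod p) ≠ 0 := by rwa [Ne, ZMod.natCast_eq_zero_iff]
  rw [Rat.cast_sub_of_ne_zero (by simp) hq, Rat.cast_one]

theorem val_neg_ratCast_one_sub {q : ℚ} (h : ¬ p ∣ q.den) :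
    (-((1 - q : ℚ) : ZMod p)).val = p - 1 - (-(q : ZMod p)).val := by
  have h1 := ZMod.val_lt (-(q : ZMod p))
  have h2 : -((1 - q : ℚ) : ZMod p) = ((p - 1 - (-(q : ZMod p)).val : ℕ) : ZMod p) := by
    rw [ratCast_zmod_one_sub h, Nat.cast_sub (by omega), Nat.cast_sub hp.out.one_le,
      ZMod.natCast_val, ZMod.cast_id]
    simp only [Nat.cast_one, CharP.cast_eq_zero]
    ring
  rw [h2, ZMod.val_natCast_of_lt (by have := hp.out.pos; omega)]

theorem dwork_one_sub {q : ℚ} (h : ¬ p ∣ q.den) : dwork p (1 - q) = 1 - dwork p q := by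
  have h1 := ZMod.val_lt (-(q : ZMod p))
  have hp0 : (p : ℚ) ≠ 0 := by exact_mod_cast hp.out.ne_zero
  apply mul_left_cancel₀ hp0
  rw [mul_dwork, mul_sub, mul_dwork, val_neg_ratCast_one_sub h, Nat.cast_sub (by omega),
    Nat.cast_sub hp.out.one_le]
  push_cast
  ring

theorem dwork_iterate_one_sub {q : ℚ} (h : ¬ p ∣ q.den) (k : ℕ) :
    (dwork p)^[k] (1 - q) = 1 - (dwork p)^[k] q := by
  induction k with
  | zero => rfl
  | succ k ih => rw [Function.iterate_succ_apply', Function.iterate_succ_apply', ih,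
      dwork_one_sub (not_dvd_den_dwork_iterate h k)]

theorem nsmul_dwork (q : ℚ) : p • (dwork p q : AddCircle (1 : ℚ)) = q := by
  rw [← AddCircle.coe_nsmul, nsmul_eq_mul, mul_dwork, AddCircle.coe_add]
  have : (((-(q : ZMod p)).val : ℚ) : AddCircle (1 : ℚ)) = 0 := by
    rw [AddCircle.coe_eq_zero_iff]
    exact ⟨((-(q : ZMod p)).val : ℤ), by simp⟩
  rw [this, add_zero]

/-- `d • 𝔇 q` is killed by `p` and by the denominator of `𝔇 q`, which are coprime. -/
theorem nsmul_coe_dwork_eq_zero {q : ℚ} (h : ¬ p ∣ q.den) {d : ℕ}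
    (hd : d • (q : AddCircle (1 : ℚ)) = 0) : d • (dwork p q : AddCircle (1 : ℚ)) = 0 := by
  have h1 : p • (d • (dwork p q : AddCircle (1 : ℚ))) = 0 := by
    rw [smul_comm, nsmul_dwork, hd]
  have h2 : (dwork p q).den • (d • (dwork p q : AddCircle (1 : ℚ))) = 0 := by
    rw [smul_comm, nsmul_class_eq_zero dvd_rfl, smul_zero]
  have h3 : Nat.Coprime p (dwork p q).den :=
    (Nat.Prime.coprime_iff_not_dvd hp.out).2 (not_dvd_den_dwork h)
  rw [← addOrderOf_dvd_iff_nsmul_eq_zero] at h1 h2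
  rw [← AddMonoid.addOrderOf_eq_one_iff]
  exact Nat.dvd_one.1 (h3 ▸ Nat.dvd_gcd h1 h2)

theorem val_natCast_nsmul {d : ℕ} {x : AddCircle (1 : ℚ)} (hx : d • x = 0) (n : ℕ) :
    (n : ZMod d).val • x = n • x := by
  rw [ZMod.val_natCast]
  conv_rhs => rw [← Nat.mod_add_div n d]
  rw [add_nsmul, mul_nsmul, hx, nsmul_zero, add_zero]

theorem val_neg_nsmul {d : ℕ} [NeZero d] {x : AddCircle (1 : ℚ)} (hx : d • x = 0) (a : ZMod d) :
    (-a).val • x = -(a.val • x) := by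
  rw [eq_neg_iff_add_eq_zero, ← add_nsmul]
  have h : d ∣ (-a).val + a.val := by
    rw [← ZMod.natCast_eq_zero_iff]
    simp
  obtain ⟨c, hc⟩ := h
  rw [hc, mul_nsmul, hx, nsmul_zero]

variable {d : ℕ} (hpd : p.Coprime d)

theorem not_dvd_den_of_dvd {d : ℕ} (hpd : p.Coprime d) {q : ℚ} (h : q.den ∣ d) : ¬ p ∣ q.den :=
  (Nat.Prime.coprime_iff_not_dvd hp.out).1 (hpd.coprime_dvd_right h)

/-- By `nsmul_dwork` the map divides by `p`, and on `d`-torsion multiplication by `p` is invertible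
because `p` is prime to `d`. -/
theorem coe_dwork_iterate {q : ℚ} (h : q.den ∣ d) (k : ℕ) :
    ((dwork p)^[k] q : AddCircle (1 : ℚ)) =
      (((ZMod.unitOfCoprime p hpd)⁻¹ ^ k : (ZMod d)ˣ) : ZMod d).val • (q : AddCircle (1 : ℚ)) := by
  have key : d • ((dwork p)^[k] q : AddCircle (1 : ℚ)) = 0 ∧
      p ^ k • ((dwork p)^[k] q : AddCircle (1 : ℚ)) = q := by
    induction k with
    | zero => exact ⟨nsmul_class_eq_zero h, by simp⟩
    | succ k ih =>
      rw [Function.iterate_succ_apply']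
      refine ⟨nsmul_coe_dwork_eq_zero (not_dvd_den_dwork_iterate (not_dvd_den_of_dvd hpd h) k) ih.1,
        ?_⟩
      rw [pow_succ', mul_nsmul, nsmul_dwork, ih.2]
  conv_rhs => rw [← key.2]
  have e : (((ZMod.unitOfCoprime p hpd)^ k : (ZMod d)ˣ) : ZMod d) = ((p ^ k : ℕ) : ZMod d) := by
    push_cast
    rw [ZMod.coe_unitOfCoprime]
  rw [← val_natCast_nsmul key.1 (p ^ k), ← e, ← val_mul_nsmul key.1, ← Units.val_mul, ← mul_pow,
    inv_mul_cancel, one_pow, Units.val_one, val_one_nsmul key.1]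

theorem classes_dworkIter {ι : Type*} {γ : ι → ℚ} (h : ∀ i, (γ i).den ∣ d) (k : ℕ) :
    classes (dworkIter p k γ) = classes (scale ((ZMod.unitOfCoprime p hpd)⁻¹ ^ k) γ) := by
  rw [classes_scale, classes, classes, ← Set.range_comp]
  congr 1
  funext i
  exact coe_dwork_iterate hpd (h i) k

theorem mem_unitStabilizer_iff {ι : Type*} {γ : ι → ℚ} (h : ∀ i, (γ i).den ∣ d)
    (lam : (ZMod d)ˣ) : lam ∈ unitStabilizer d γ h ↔ classes (scale lam γ) = classes γ := Iff.rfl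

theorem classes_dworkIter_eq_iff {ι : Type*} {γ : ι → ℚ} (h : ∀ i, (γ i).den ∣ d) (k : ℕ) :
    classes (dworkIter p k γ) = classes γ ↔
      (ZMod.unitOfCoprime p hpd) ^ k ∈ unitStabilizer d γ h := by
  rw [classes_dworkIter hpd h, ← mem_unitStabilizer_iff h, inv_pow, inv_mem_iff]

theorem classes_dworkIter_of_neg_mem [NeZero d] {ι : Type*} {γ : ι → ℚ}
    (h : ∀ i, (γ i).den ∣ d) (k : ℕ)
    (hk : -(ZMod.unitOfCoprime p hpd) ^ k ∈ unitStabilizer d γ h) :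
    classes (dworkIter p k γ) = classes fun i => 1 - γ i := by
  have h1 := inv_mem hk
  rw [mem_unitStabilizer_iff, classes_scale] at h1
  have e : (ZMod.unitOfCoprime p hpd)⁻¹ ^ k = -(-(ZMod.unitOfCoprime p hpd) ^ k)⁻¹ := by
    rw [inv_neg, neg_neg, inv_pow]
  have h2 : classes (fun i => 1 - γ i) = Neg.neg '' classes γ := by
    rw [classes, classes, ← Set.range_comp]
    congr 1
    funext i
    simp [AddCircle.coe_period]
  rw [classes_dworkIter hpd h, classes_scale, e, h2]
  conv_rhs => rw [← h1]
  rw [Set.image_image]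
  refine Set.image_congr fun x hx => ?_
  rw [Units.val_neg, val_neg_nsmul (nsmul_eq_zero_of_mem_classes h hx)]

/-- A class modulo `ℤ` has at most one representative in `(0, 1)`. The set loses no multiplicity
here: an equality of unordered pairs matches the entries in one of two orders. -/
theorem eq_or_eq_swap_of_classes_eq {γ δ : Fin 2 → ℚ} (hγ : ∀ i, 0 < γ i ∧ γ i < 1)
    (hδ : ∀ i, 0 < δ i ∧ δ i < 1) (h : classes γ = classes δ) :
    γ = δ ∨ γ = fun i => δ (Equiv.swap 0 1 i) := by
  have hinj : ∀ {a b : ℚ}, (0 < a ∧ a < 1) → (0 < b ∧ b < 1) →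
      (a : AddCircle (1 : ℚ)) = b → a = b := by
    intro a b ha hb hab
    have : Fact ((0 : ℚ) < 1) := ⟨one_pos⟩
    exact (AddCircle.coe_eq_coe_iff_of_mem_Ico (p := (1 : ℚ)) (a := 0) ⟨ha.1.le, by linarith [ha.2]⟩
      ⟨hb.1.le, by linarith [hb.2]⟩).1 hab
  have hr : ∀ f : Fin 2 → ℚ, classes f = {((f 0 : ℚ) : AddCircle (1 : ℚ)), ((f 1 : ℚ) : AddCircle (1 : ℚ))} := by
    intro f
    ext x
    simp [classes, Fin.exists_fin_two, eq_comm]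
  rw [hr, hr, Set.pair_eq_pair_iff] at h
  rcases h with ⟨h0, h1⟩ | ⟨h0, h1⟩
  · left
    funext i
    fin_cases i
    · exact hinj (hγ 0) (hδ 0) h0
    · exact hinj (hγ 1) (hδ 1) h1
  · right
    funext i
    fin_cases i
    · simpa using hinj (hγ 0) (hδ 1) h0
    · simpa using hinj (hγ 1) (hδ 0) h1

theorem hypCoeff_swap (γ : Fin 2 → ℚ) : hypCoeff (fun i => γ (Equiv.swap 0 1 i)) = hypCoeff γ := by
  funext n
  simp only [hypCoeff, ordinaryHypergeometricCoefficient, Equiv.swap_apply_left,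
    Equiv.swap_apply_right]
  ring

theorem hypCoeff_eq_of_classes_eq {γ δ : Fin 2 → ℚ} (hγ : ∀ i, 0 < γ i ∧ γ i < 1)
    (hδ : ∀ i, 0 < δ i ∧ δ i < 1) (h : classes γ = classes δ) : hypCoeff γ = hypCoeff δ := by
  rcases eq_or_eq_swap_of_classes_eq hγ hδ h with rfl | rfl
  · rfl
  · exact hypCoeff_swap δ

theorem den_dvd_commonDenom_left {ι κ : Type*} [Fintype ι] [Fintype κ] (α : ι → ℚ) (β : κ → ℚ)
    (i : ι) : (α i).den ∣ commonDenom α β :=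
  (Finset.dvd_lcm (Finset.mem_univ i)).trans (Nat.dvd_lcm_left _ _)

theorem den_dvd_commonDenom_right {ι κ : Type*} [Fintype ι] [Fintype κ] (α : ι → ℚ) (β : κ → ℚ)
    (j : κ) : (β j).den ∣ commonDenom α β :=
  (Finset.dvd_lcm (Finset.mem_univ j)).trans (Nat.dvd_lcm_right _ _)

theorem dworkOrder_eq {ι κ : Type*} [Fintype ι] [Fintype κ] (α : ι → ℚ) (β : κ → ℚ)
    (h : p.Coprime (commonDenom α β)) : dworkOrder p α β =
      sInf {l : ℕ | 0 < l ∧ (ZMod.unitOfCoprime p h) ^ l ∈ groupD α β} := by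
  rw [dworkOrder]
  congr 1
  ext l
  simp only [Set.mem_ofPred_eq]
  rw [classes_dworkIter_eq_iff h (den_dvd_commonDenom_left α β),
    classes_dworkIter_eq_iff h (den_dvd_commonDenom_right α β)]
  rfl

theorem dworkOrder_spec {ι κ : Type*} [Fintype ι] [Fintype κ] (α : ι → ℚ) (β : κ → ℚ)
    (h : p.Coprime (commonDenom α β)) : 0 < dworkOrder p α β ∧
      (ZMod.unitOfCoprime p h) ^ dworkOrder p α β ∈ groupD α β := by
  rw [dworkOrder_eq α β h]
  exact Nat.sInf_mem (s := {l : ℕ | 0 < l ∧ (ZMod.unitOfCoprime p h) ^ l ∈ groupD α β})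
    ⟨orderOf (ZMod.unitOfCoprime p h), orderOf_pos _, by rw [pow_orderOf_eq_one]; exact one_mem _⟩

theorem dworkOrder_dvd {ι κ : Type*} [Fintype ι] [Fintype κ] (α : ι → ℚ) (β : κ → ℚ)
    (h : p.Coprime (commonDenom α β)) {f : ℕ} (hf : (ZMod.unitOfCoprime p h) ^ f ∈ groupD α β) :
    dworkOrder p α β ∣ f := by
  obtain ⟨h1, h2⟩ := dworkOrder_spec α β h
  rw [Nat.dvd_iff_mod_eq_zero]
  by_contra hne
  have h3 : (ZMod.unitOfCoprime p h) ^ (f % dworkOrder p α β) ∈ groupD α β := by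
    rw [← Nat.mod_add_div f (dworkOrder p α β), pow_add, pow_mul] at hf
    exact (Subgroup.mul_mem_cancel_right _ (pow_mem h2 _)).1 hf
  have h4 : dworkOrder p α β ≤ f % dworkOrder p α β := by
    conv_lhs => rw [dworkOrder_eq α β h]
    exact Nat.sInf_le ⟨Nat.pos_of_ne_zero hne, h3⟩
  exact absurd (Nat.mod_lt f h1) (not_lt.2 h4)

theorem classes_dworkIter_dworkOrder {ι κ : Type*} [Fintype ι] [Fintype κ] (α : ι → ℚ)
    (β : κ → ℚ) (h : p.Coprime (commonDenom α β)) :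
    classes (dworkIter p (dworkOrder p α β) α) = classes α :=
  (classes_dworkIter_eq_iff h (den_dvd_commonDenom_left α β) _).2 (dworkOrder_spec α β h).2.1

end Dwork

/-! ### Factorization of `A` and its root. -/

section Factorization

variable {p : ℕ} [hp : Fact p.Prime]

theorem one_sub_X_ne_zero (F : Type*) [Field F] : (1 - RatFunc.X : RatFunc F) ≠ 0 := by
  have h : (1 - Polynomial.X : F[X]) ≠ 0 := by
    intro h
    have := congrArg (Polynomial.eval 0) h
    simp at this
  have h2 := (map_ne_zero_iff _ (IsFractionRing.injective F[X] (RatFunc F))).2 h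
  simpa using h2

/-- Euler's transformation for the truncations modulo `p` of `₂F₁(α, (1); x)`. -/
theorem euler_transformation_trunc {α : Fin 2 → ℚ} (h : ∀ i, ¬ p ∣ (α i).den) :
    algebraMap (ZMod p)[X] (RatFunc (ZMod p)) (PowerSeries.trunc p (hypMod (ZMod p) α)) =
      (1 - RatFunc.X) ^ ((-(α 0 : ZMod p)).val + (-(α 1 : ZMod p)).val + 1 - p : ℤ) *
        algebraMap (ZMod p)[X] (RatFunc (ZMod p))
          (PowerSeries.trunc p (hypMod (ZMod p) fun i => 1 - α i)) := by
  have h' : ∀ i, ¬ p ∣ (1 - α i).den := by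
    intro i
    rw [show (1 - α i : ℚ) = ((1 : ℤ) : ℚ) - α i by simp, Rat.intCast_sub_den]
    exact h i
  rw [trunc_hypMod h, trunc_hypMod (α := fun i => 1 - α i) h']
  rw [val_neg_ratCast_one_sub (h 0), val_neg_ratCast_one_sub (h 1)]
  have h1 := congrArg (algebraMap (ZMod p)[X] (RatFunc (ZMod p)))
    (euler_transformation_chooseMulPoly _ _ (ZMod.val_lt (-(α 0 : ZMod p)))
      (ZMod.val_lt (-(α 1 : ZMod p))))
  simp only [map_mul, map_pow, map_sub, map_one, RatFunc.algebraMap_X] at h1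
  have h0 := one_sub_X_ne_zero (ZMod p)
  -- The exponent may be negative, whence the passage to rational functions.
  rw [zpow_sub₀ h0, zpow_natCast, div_mul_eq_mul_div, eq_div_iff (pow_ne_zero _ h0), mul_comm, h1]
  norm_cast

/-- The Dwork map commutes with `q ↦ 1 - q`, and the series is symmetric in its two upper
parameters. -/
theorem polyB_eq_of_classes_eq {α : Fin 2 → ℚ} (hα : ∀ i, 0 < α i ∧ α i < 1)
    (hα' : ∀ i, ¬ p ∣ (α i).den) {e : ℕ}
    (he : classes (dworkIter p e α) = classes fun i => 1 - α i) (k : ℕ) :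
    polyB p α (e + k) =
      PowerSeries.trunc p (hypMod (ZMod p) fun i => 1 - dworkIter p k α i) := by
  have h1 : ∀ i, 0 < 1 - α i ∧ 1 - α i < 1 := fun i =>
    ⟨by linarith [(hα i).2], by linarith [(hα i).1]⟩
  have h2 : hypCoeff (dworkIter p (e + k) α) = hypCoeff fun i => 1 - dworkIter p k α i := by
    rcases eq_or_eq_swap_of_classes_eq (fun i => dwork_iterate_mem_Ioo (hα i) e) h1 he with h | h
    · congr 1
      funext i
      have := congrFun h i
      simp only [dworkIter] at this ⊢
      rw [add_comm, Function.iterate_add_apply, this, dwork_iterate_one_sub (hα' i)]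
    · rw [← hypCoeff_swap fun i => 1 - dworkIter p k α i]
      congr 1
      funext i
      have := congrFun h i
      simp only [dworkIter] at this ⊢
      rw [add_comm, Function.iterate_add_apply, this, dwork_iterate_one_sub (hα' _)]
  rw [polyB, hypMod, hypMod, h2]

theorem zpow_finset_sum {G ι : Type*} [CommGroupWithZero G] {x : G} (hx : x ≠ 0) (s : Finset ι)
    (f : ι → ℤ) : x ^ (∑ i ∈ s, f i) = ∏ i ∈ s, x ^ f i := by
  classical
  induction s using Finset.induction_on with
  | empty => simp
  | insert a s ha ih => rw [Finset.sum_insert ha, Finset.prod_insert ha, zpow_add₀ hx, ih]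

/-- Telescoping of `p * 𝔇 q = q + r`: the remainders are the base `p` digits of `-q`. -/
theorem sum_pow_mul_val_eq {q : ℚ} (e : ℕ) :
    ∑ k ∈ Finset.range e, (p : ℚ) ^ k * ((-(((dwork p)^[k] q : ℚ) : ZMod p)).val : ℚ) =
      (p : ℚ) ^ e * (dwork p)^[e] q - q := by
  induction e with
  | zero => simp
  | succ e ih =>
    rw [Finset.sum_range_succ, ih, Function.iterate_succ_apply', pow_succ, mul_assoc, mul_dwork]
    ring

theorem polyA_eq_of_classes_eq {α : Fin 2 → ℚ} (hα : ∀ i, 0 < α i ∧ α i < 1)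
    (hα' : ∀ i, ¬ p ∣ (α i).den) {e : ℕ}
    (he : classes (dworkIter p e α) = classes fun i => 1 - α i)
    (hl : dworkOrder p α ![1] = e + e) :
    ∃ v : ℤ, (v : ℚ) = (1 + (p : ℚ) ^ e) * (1 - α 0 - α 1) ∧
      algebraMap (ZMod p)[X] (RatFunc (ZMod p)) (polyA p α) =
        (1 - RatFunc.X) ^ v * algebraMap (ZMod p)[X] (RatFunc (ZMod p))
          (∏ k ∈ Finset.range e, polyB p α (e + k) ^ p ^ k) ^ (1 + p ^ e) := by
  have h1 : ∀ i, 0 < 1 - α i ∧ 1 - α i < 1 := fun i =>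
    ⟨by linarith [(hα i).2], by linarith [(hα i).1]⟩
  -- `s k` is the exponent of `1 - x` given by Euler's transformation for `B_k`; the total exponent
  -- is `∑ p^k * s k`.
  set s : ℕ → ℤ := fun k => (-(((dwork p)^[k] (α 0) : ℚ) : ZMod p)).val +
    (-(((dwork p)^[k] (α 1) : ℚ) : ZMod p)).val + 1 - p with hs
  refine ⟨∑ k ∈ Finset.range e, (p : ℤ) ^ k * s k, ?_, ?_⟩
  · have e1 : (dwork p)^[e] (α 0) + (dwork p)^[e] (α 1) = 2 - α 0 - α 1 := by
      rcases eq_or_eq_swap_of_classes_eq (fun i => dwork_iterate_mem_Ioo (hα i) e) h1 he with h | h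
      · have h0 := congrFun h 0
        have h1 := congrFun h 1
        change (dwork p)^[e] (α 0) = 1 - α 0 at h0
        change (dwork p)^[e] (α 1) = 1 - α 1 at h1
        rw [h0, h1]
        ring
      · have h0 := congrFun h 0
        have h1 := congrFun h 1
        rw [Equiv.swap_apply_left] at h0
        rw [Equiv.swap_apply_right] at h1
        change (dwork p)^[e] (α 0) = 1 - α 1 at h0
        change (dwork p)^[e] (α 1) = 1 - α 0 at h1
        rw [h0, h1]
        ring
    have e2 := sum_pow_mul_val_eq (p := p) (q := α 0) e
    have e3 := sum_pow_mul_val_eq (p := p) (q := α 1) e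
    have e4 : ∑ k ∈ Finset.range e, (p : ℚ) ^ k * (p - 1) = (p : ℚ) ^ e - 1 := by
      rw [← Finset.sum_mul, geom_sum_mul]
    have e5 : ((∑ k ∈ Finset.range e, (p : ℤ) ^ k * s k : ℤ) : ℚ) =
        ∑ k ∈ Finset.range e, (p : ℚ) ^ k * ((-(((dwork p)^[k] (α 0) : ℚ) : ZMod p)).val : ℚ) +
        ∑ k ∈ Finset.range e, (p : ℚ) ^ k * ((-(((dwork p)^[k] (α 1) : ℚ) : ZMod p)).val : ℚ) -
        ∑ k ∈ Finset.range e, (p : ℚ) ^ k * (p - 1) := by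
      rw [← Finset.sum_add_distrib, ← Finset.sum_sub_distrib]
      push_cast
      refine Finset.sum_congr rfl fun k _ => ?_
      simp only [hs]
      push_cast
      ring
    rw [e5, e2, e3, e4]
    linear_combination (p : ℚ) ^ e * e1
  · have h0 := one_sub_X_ne_zero (ZMod p)
    have e1 : ∀ k, algebraMap (ZMod p)[X] (RatFunc (ZMod p)) (polyB p α k) =
        (1 - RatFunc.X) ^ s k *
          algebraMap (ZMod p)[X] (RatFunc (ZMod p)) (polyB p α (e + k)) := by
      intro k
      rw [polyB_eq_of_classes_eq hα hα' he, polyB]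
      exact euler_transformation_trunc fun i => not_dvd_den_dwork_iterate (hα' i) k
    -- The second half of the product is the `p^e`-th power of `P = ∏ B_{e+k} ^ p^k`; by `e3` the
    -- first half is `P` times the power of `1 - x`.
    have e2 : polyA p α = (∏ k ∈ Finset.range e, polyB p α k ^ p ^ k) *
        (∏ k ∈ Finset.range e, polyB p α (e + k) ^ p ^ k) ^ p ^ e := by
      rw [polyA, hl, Finset.prod_range_add, ← Finset.prod_pow]
      congr 1
      refine Finset.prod_congr rfl fun k _ => ?_
      rw [← pow_mul, ← pow_add, add_comm]
    have e3 : algebraMap (ZMod p)[X] (RatFunc (ZMod p))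
        (∏ k ∈ Finset.range e, polyB p α k ^ p ^ k) =
        (1 - RatFunc.X) ^ (∑ k ∈ Finset.range e, (p : ℤ) ^ k * s k) *
          algebraMap (ZMod p)[X] (RatFunc (ZMod p))
            (∏ k ∈ Finset.range e, polyB p α (e + k) ^ p ^ k) := by
      rw [map_prod, map_prod, zpow_finset_sum h0, ← Finset.prod_mul_distrib]
      refine Finset.prod_congr rfl fun k _ => ?_
      rw [map_pow, map_pow, e1, mul_pow, ← zpow_natCast, ← zpow_mul, mul_comm (s k)]
      norm_cast
    rw [e2, map_mul, e3, map_pow]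
    ring

/-- If the rational function `h` has a power which is a polynomial, it is a polynomial. -/
theorem exists_polynomial_of_pow_eq {F : Type*} [Field F] {h : RatFunc F} {n : ℕ} (hn : 0 < n)
    {A : F[X]} (hA : algebraMap F[X] (RatFunc F) A = h ^ n) :
    ∃ g : F[X], algebraMap F[X] (RatFunc F) g = h := by
  have : IsIntegral F[X] h := IsIntegral.of_pow hn (hA ▸ isIntegral_algebraMap)
  exact IsIntegrallyClosed.isIntegral_iff.1 this

theorem den_dvd_of_intCast_eq {q : ℚ} {v : ℤ} {n : ℕ} (h : (v : ℚ) = n * q) : q.den ∣ n := by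
  rw [← Int.natCast_dvd_natCast]
  have h1 : (n : ℤ) * q.num = v * q.den := by
    have := Rat.mul_den_eq_num q
    have h2 : ((n : ℚ) * q.num) = v * q.den := by rw [← this, h]; ring
    exact_mod_cast h2
  have h3 : IsCoprime (q.den : ℤ) q.num := by
    rw [Int.isCoprime_iff_gcd_eq_one, Int.gcd_comm]
    exact q.reduced
  exact h3.dvd_of_dvd_mul_right ⟨v, by rw [h1]; ring⟩

theorem exists_pow_eq_polyA {α : Fin 2 → ℚ} (hα : ∀ i, 0 < α i ∧ α i < 1)
    (hα' : ∀ i, ¬ p ∣ (α i).den) {e : ℕ}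
    (he : classes (dworkIter p e α) = classes fun i => 1 - α i)
    (hl : dworkOrder p α ![1] = e + e) :
    (α 0 + α 1).den ∣ 1 + p ^ e ∧
      ∃ g : (ZMod p)[X], polyA p α = g ^ ((1 + p ^ e) / (α 0 + α 1).den) := by
  obtain ⟨v, hv, hA⟩ := polyA_eq_of_classes_eq hα hα' he hl
  have hm : (α 0 + α 1).den ∣ 1 + p ^ e := by
    -- `(1 + p^e) * (α 0 + α 1) = 1 + p^e - v` is an integer.
    refine den_dvd_of_intCast_eq (v := (1 + (p : ℤ) ^ e) - v) ?_
    push_cast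
    rw [hv]
    ring
  refine ⟨hm, ?_⟩
  obtain ⟨n, hn⟩ := hm
  have hd : 0 < (α 0 + α 1).den := (α 0 + α 1).den_pos
  have hn0 : 0 < n := by
    rcases Nat.eq_zero_or_pos n with rfl | h
    · simp at hn
    · exact h
  rw [hn, Nat.mul_div_cancel_left _ hd]
  -- The quotient `n` of `1 + p^e` by the denominator divides `v` too, so `A` is an `n`-th power of
  -- a rational function, necessarily a polynomial.
  have hv' : v = ((α 0 + α 1).den - (α 0 + α 1).num : ℤ) * n := by
    have h1 := Rat.mul_den_eq_num (α 0 + α 1)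
    have h2 : (1 + (p : ℚ) ^ e) = (α 0 + α 1).den * n := by exact_mod_cast hn
    have h3 : (v : ℚ) = (((α 0 + α 1).den - (α 0 + α 1).num : ℤ) * n : ℤ) := by
      rw [hv, h2]
      push_cast
      linear_combination (-n : ℚ) * h1
    exact_mod_cast h3
  rw [hv', hn, zpow_mul, zpow_natCast, pow_mul, ← mul_pow] at hA
  obtain ⟨g, hg⟩ := exists_polynomial_of_pow_eq hn0 hA
  refine ⟨g, IsFractionRing.injective (ZMod p)[X] (RatFunc (ZMod p)) ?_⟩
  rw [hA, map_pow, hg]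

end Factorization

/-! ### Kummer theory with roots of unity in a constant field. -/

section Kummer

variable {k F E : Type*} [Field k] [Field F] [Field E] [Algebra k F] [Algebra F E]

theorem minpoly_dvd_X_pow_sub_C {N : ℕ} {a : E} {c : F} (h : a ^ N = algebraMap F E c) :
    minpoly F a ∣ Polynomial.X ^ N - Polynomial.C c := by
  apply minpoly.dvd
  simp [h]

theorem isSeparable_of_pow_eq {N : ℕ} (hNF : (N : F) ≠ 0) {a : E} (ha : a ≠ 0) {c : F}
    (h : a ^ N = algebraMap F E c) : IsSeparable F a := by
  have hc : c ≠ 0 := by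
    rintro rfl
    rw [map_zero] at h
    exact ha ((pow_eq_zero_iff (by rintro rfl; simp at hNF)).1 h)
  exact (Polynomial.separable_X_pow_sub_C c hNF hc).of_dvd (minpoly_dvd_X_pow_sub_C h)

/-- The Kummer character of an `N`-th root, when the base field contains the `N`-th roots of
unity of `k`. -/
theorem exists_kummer_character {N : ℕ} (hN : 0 < N) {ζ : k} (hζ : IsPrimitiveRoot ζ N)
    {a : E} (ha : a ≠ 0) {c : F} (h : a ^ N = algebraMap F E c) :
    ∃ φ : (minpoly F a).Gal →* kˣ, Function.Injective φ ∧
      ∀ σ, φ σ ∈ rootsOfUnity N k := by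
  classical
  have hint : IsIntegral F a := IsIntegral.of_pow hN (h ▸ isIntegral_algebraMap)
  set S := (minpoly F a).SplittingField
  set j : k →+* S := (algebraMap F S).comp (algebraMap k F)
  have hjζ : IsPrimitiveRoot (j ζ) N := hζ.map_of_injective j.injective
  have hc : c ≠ 0 := by
    rintro rfl
    rw [map_zero] at h
    exact ha ((pow_eq_zero_iff hN.ne').1 h)
  have hroot : ∀ y : S, Polynomial.aeval y (minpoly F a) = 0 → y ^ N = algebraMap F S c := by
    intro y hy
    obtain ⟨q, hq⟩ := minpoly_dvd_X_pow_sub_C h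
    have := congrArg (Polynomial.aeval y) hq
    rw [map_mul, hy, zero_mul] at this
    simpa [sub_eq_zero] using this
  -- `a` lies in `E`, not in the abstract splitting field `S`, so a root `b` of its minimal
  -- polynomial in `S` takes its place.
  obtain ⟨b, hb⟩ : ∃ b : S, Polynomial.aeval b (minpoly F a) = 0 := by
    have hs := Polynomial.SplittingField.splits (minpoly F a)
    obtain ⟨b, hb⟩ := hs.exists_eval_eq_zero (by
      rw [Polynomial.degree_map]
      exact (minpoly.degree_pos hint).ne')
    exact ⟨b, by rwa [Polynomial.eval_map_algebraMap] at hb⟩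
  have hb0 : b ≠ 0 := by
    rintro rfl
    have := hroot 0 hb
    rw [zero_pow hN.ne', eq_comm, map_eq_zero] at this
    exact hc this
  have hex : ∀ y : S, Polynomial.aeval y (minpoly F a) = 0 → ∃ z : k, z ^ N = 1 ∧ y = j z * b := by
    intro y hy
    have h1 : (y / b) ^ N = 1 := by
      rw [div_pow, hroot y hy, hroot b hb, div_self]
      simpa using hc
    have : NeZero N := ⟨hN.ne'⟩
    obtain ⟨i, -, hi⟩ := hjζ.eq_pow_of_pow_eq_one h1
    refine ⟨ζ ^ i, by rw [← pow_mul, mul_comm, pow_mul, hζ.pow_eq_one, one_pow], ?_⟩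
    rw [map_pow, hi, div_mul_cancel₀ _ hb0]
  have hσ : ∀ σ : (minpoly F a).Gal, ∃ z : k, z ^ N = 1 ∧ σ b = j z * b := by
    intro σ
    apply hex
    have := Polynomial.aeval_algHom_apply (AlgEquiv.toAlgHom (σ : S ≃ₐ[F] S)) b (minpoly F a)
    rw [hb, map_zero] at this
    exact this
  have hfix : ∀ (σ : (minpoly F a).Gal) (z : k), σ (j z) = j z := fun σ z =>
    (σ : S ≃ₐ[F] S).commutes (algebraMap k F z)
  choose z hz1 hz2 using hσ
  have hcancel : ∀ x y : k, j x * b = j y * b → x = y := fun x y hxy =>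
    j.injective (mul_right_cancel₀ hb0 hxy)
  let φ : (minpoly F a).Gal →* k :=
    { toFun := z
      map_one' := by
        apply hcancel
        rw [← hz2, map_one, one_mul]
        rfl
      map_mul' := by
        intro σ τ
        apply hcancel
        rw [← hz2]
        change σ (τ b) = _
        rw [hz2 τ, map_mul, hfix, hz2 σ, map_mul]
        ring }
  refine ⟨φ.toHomUnits, ?_, ?_⟩
  · intro σ τ hστ
    have h1 : z σ = z τ := congrArg Units.val hστ
    -- All roots are multiples of `b` by elements of `k`, so an automorphism is determined by its
    -- value at `b`.
    apply Polynomial.Gal.ext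
    intro x hx
    obtain ⟨w, -, rfl⟩ := hex x (Polynomial.aeval_eq_zero_of_mem_rootSet hx)
    rw [map_mul, map_mul, hfix, hfix, hz2, hz2, h1]
  · intro σ
    rw [mem_rootsOfUnity']
    exact hz1 σ

theorem card_gal_dvd_of_pow_eq {N : ℕ} (hN : 0 < N) {ζ : k} (hζ : IsPrimitiveRoot ζ N)
    {a : E} (ha : a ≠ 0) {c : F} (h : a ^ N = algebraMap F E c) :
    Nat.card (minpoly F a).Gal ∣ N := by
  obtain ⟨φ, hφ, hφ'⟩ := exists_kummer_character hN hζ ha h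
  have : NeZero N := ⟨hN.ne'⟩
  have h1 : φ.range ≤ rootsOfUnity N k := by
    rintro _ ⟨σ, rfl⟩
    exact hφ' σ
  have h2 := Subgroup.card_dvd_of_le h1
  rwa [hζ.card_rootsOfUnity,
    ← Nat.card_congr (MonoidHom.ofInjective hφ).toEquiv] at h2

end Kummer

/-! ### Frobenius elements and residue fields of `K`. -/

section ResidueField

variable {p : ℕ} [hp : Fact p.Prime]

theorem autEquivPow_mem_of_fixes {ι κ : Type*} [Fintype ι] [Fintype κ] (α : ι → ℚ) (β : κ → ℚ)
    (L : Type*) [Field L] [CharZero L] [IsCyclotomicExtension {commonDenom α β} ℚ L]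
    (σ : Gal(L/ℚ)) (hσ : ∀ x : fieldK α β L, σ (x : L) = x) :
    IsCyclotomicExtension.autEquivPow L (Polynomial.cyclotomic.irreducible_rat
        (Nat.pos_of_ne_zero (commonDenom_ne_zero α β))) σ ∈ groupD α β := by
  have := IsCyclotomicExtension.finiteDimensional {commonDenom α β} ℚ L
  have h1 : σ ∈ (fieldK α β L).fixingSubgroup := by
    rw [IntermediateField.mem_fixingSubgroup_iff]
    exact fun x hx => hσ ⟨x, hx⟩
  rw [fieldK, IntermediateField.fixingSubgroup_fixedField] at h1
  exact h1

theorem exists_natCard_eq_pow_of_natCast_eq_zero {k : Type*} [Field k] [Finite k]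
    (h : (p : k) = 0) : ∃ f : ℕ, Nat.card k = p ^ f := by
  have : CharP k p := (CharP.charP_iff_prime_eq_zero hp.out).2 h
  have := Fintype.ofFinite k
  obtain ⟨n, -, hn⟩ := FiniteField.card k p
  exact ⟨n, by rw [Nat.card_eq_fintype_card, hn]⟩

/-- The residue degrees of the primes of `K` above `p` are exponents of powers of `p` in `D`. -/
theorem exists_card_quotient_eq_pow {ι κ : Type*} [Fintype ι] [Fintype κ] (α : ι → ℚ) (β : κ → ℚ)
    (h : p.Coprime (commonDenom α β))
    (L : Type*) [Field L] [CharZero L] [IsCyclotomicExtension {commonDenom α β} ℚ L]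
    (𝔭 : Ideal (𝓞 (fieldK α β L))) [𝔭.IsPrime] (hp𝔭 : (p : 𝓞 (fieldK α β L)) ∈ 𝔭) :
    Finite (𝓞 (fieldK α β L) ⧸ 𝔭) ∧ ∃ f : ℕ, Nat.card (𝓞 (fieldK α β L) ⧸ 𝔭) = p ^ f ∧
      (ZMod.unitOfCoprime p h) ^ f ∈ groupD α β := by
  have : NumberField L := IsCyclotomicExtension.numberField {commonDenom α β} ℚ L
  have : IsGalois ℚ L := IsCyclotomicExtension.isGalois {commonDenom α β} ℚ L
  have hfin : Finite (𝓞 (fieldK α β L) ⧸ 𝔭) := by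
    refine Ideal.finiteQuotientOfFreeOfNeBot 𝔭 ?_
    rintro rfl
    rw [Ideal.mem_bot] at hp𝔭
    exact hp.out.ne_zero (by exact_mod_cast hp𝔭)
  refine ⟨hfin, ?_⟩
  have hmax : 𝔭.IsMaximal :=
    Ideal.Quotient.maximal_of_isField _ (Finite.isField_of_domain (𝓞 (fieldK α β L) ⧸ 𝔭))
  have hpow : ∃ f : ℕ, Nat.card (𝓞 (fieldK α β L) ⧸ 𝔭) = p ^ f := by
    let _ := Ideal.Quotient.field 𝔭
    refine exists_natCard_eq_pow_of_natCast_eq_zero ?_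
    rw [← map_natCast (Ideal.Quotient.mk 𝔭)]
    exact Ideal.Quotient.eq_zero_iff_mem.2 hp𝔭
  obtain ⟨f, hf⟩ := hpow
  refine ⟨f, hf, ?_⟩
  obtain ⟨Q, hQ1, hQ2⟩ := Ideal.exists_maximal_ideal_liesOver_of_isIntegral (S := 𝓞 L) 𝔭
  have hpQ : (p : 𝓞 L) ∈ Q := by
    have : (p : 𝓞 (fieldK α β L)) ∈ Q.under (𝓞 (fieldK α β L)) := hQ2.over ▸ hp𝔭
    simpa using this
  have hfinQ : Finite (𝓞 L ⧸ Q) := by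
    refine Ideal.finiteQuotientOfFreeOfNeBot Q ?_
    rintro rfl
    rw [Ideal.mem_bot] at hpQ
    exact hp.out.ne_zero (by exact_mod_cast hpQ)
  -- Away from `d`, roots of unity of order `d` stay distinct modulo `Q`, so the Frobenius
  -- congruence at `ζ_d` becomes an equality in `h1`.
  have hdQ : (commonDenom α β : 𝓞 L) ∉ Q := by
    intro hdQ
    apply hQ1.ne_top
    rw [Ideal.eq_top_iff_one]
    obtain ⟨a, b, hab⟩ := Nat.isCoprime_iff_coprime.2 h
    have := congrArg (Int.cast : ℤ → 𝓞 L) hab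
    push_cast at this
    rw [← this]
    exact Q.add_mem (Q.mul_mem_left _ hpQ) (Q.mul_mem_left _ hdQ)
  have hG : IsGaloisGroup Gal(L/fieldK α β L) (𝓞 (fieldK α β L)) (𝓞 L) := inferInstance
  have := hG.isInvariant
  have := hG.commutes
  obtain ⟨σ, hσ⟩ := IsArithFrobAt.exists_of_isInvariant (𝓞 (fieldK α β L)) Gal(L/fieldK α β L) Q
  have hζ := IsCyclotomicExtension.zeta_spec (commonDenom α β) ℚ L
  have h1 : σ (IsCyclotomicExtension.zeta (commonDenom α β) ℚ L) = IsCyclotomicExtension.zeta (commonDenom α β) ℚ L ^ p ^ f := by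
    have h2 := AlgHom.IsArithFrobAt.apply_of_pow_eq_one hσ (ζ := hζ.toInteger)
      hζ.toInteger_isPrimitiveRoot.pow_eq_one hdQ
    rw [← hQ2.over, hf] at h2
    exact congrArg (algebraMap (𝓞 L) L) h2
  -- The Frobenius element fixes `K`, so its exponent on `ζ_d`, which is `p^f`, lies in `D`.
  have h3 := autEquivPow_mem_of_fixes α β L (σ.restrictScalars ℚ) fun x => σ.commutes x
  convert h3
  apply Units.ext
  have h4 := hζ.autToPow_spec ℚ (σ.restrictScalars ℚ)
  have h5 : IsCyclotomicExtension.zeta (commonDenom α β) ℚ L ^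
      ((hζ.autToPow ℚ (σ.restrictScalars ℚ) : ZMod (commonDenom α β))).val =
      IsCyclotomicExtension.zeta (commonDenom α β) ℚ L ^ p ^ f := h4.trans h1
  have h6 := (hζ.isOfFinOrder (commonDenom_ne_zero α β)).pow_eq_pow_iff_modEq.1 h5
  rw [← hζ.eq_orderOf, ← ZMod.natCast_eq_natCast_iff, ZMod.natCast_val, ZMod.cast_id] at h6
  rw [Units.val_pow_eq_pow_val, ZMod.coe_unitOfCoprime, ← Nat.cast_pow, ← h6]
  rfl

end ResidueField

/-! ### Powers of the hypergeometric series that are rational functions. -/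

section Laurent

variable {p : ℕ} [hp : Fact p.Prime]

theorem algebraMap_ratFunc_laurent {F : Type*} [Field F] (A : F[X]) :
    algebraMap (RatFunc F) (LaurentSeries F) (algebraMap F[X] (RatFunc F) A) =
      HahnSeries.ofPowerSeries ℤ F (A : F⟦X⟧) := by
  change IsFractionRing.lift (FaithfulSMul.algebraMap_injective F[X] (LaurentSeries F))
    (algebraMap F[X] (RatFunc F) A) = _
  rw [IsFractionRing.lift_algebraMap]
  rfl

variable {F : Type*} [Field F] [Algebra (ZMod p) F] {α : Fin 2 → ℚ}

theorem constantCoeff_hypMod : PowerSeries.constantCoeff (hypMod F α) = 1 := by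
  rw [← PowerSeries.coeff_zero_eq_constantCoeff_apply, hypMod, PowerSeries.coeff_mk, hypCoeff_zero,
    Rat.cast_one]

theorem hypMod_ne_zero : hypMod F α ≠ 0 := by
  intro h
  have := constantCoeff_hypMod (F := F) (α := α)
  rw [h, map_zero] at this
  exact zero_ne_one this

theorem hypLaurent_ne_zero : hypLaurent F α ≠ 0 := by
  rw [hypLaurent, Ne, map_eq_zero_iff _ HahnSeries.ofPowerSeries_injective]
  exact hypMod_ne_zero

variable (F) in
theorem mul_hypMod_pow_eq_one (hα : ∀ i, 0 < α i ∧ α i < 1) (hα' : ∀ i, ¬ p ∣ (α i).den)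
    (hl : classes (dworkIter p (dworkOrder p α ![1]) α) = classes α) :
    (((polyA p α).map (algebraMap (ZMod p) F) : F[X]) : F⟦X⟧) *
      hypMod F α ^ (p ^ dworkOrder p α ![1] - 1) = 1 := by
  have h1 := hypMod_eq_prod_mul_pow (p := p) hα' (dworkOrder p α ![1])
  have h2 : hypMod (ZMod p) (dworkIter p (dworkOrder p α ![1]) α) = hypMod (ZMod p) α := by
    rw [hypMod, hypMod,
      hypCoeff_eq_of_classes_eq (γ := dworkIter p _ α) (fun i => dwork_iterate_mem_Ioo (hα i) _) hα hl]
  rw [h2] at h1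
  have h3 := congrArg (PowerSeries.map (algebraMap (ZMod p) F)) h1
  rw [map_mul, map_pow, hypMod_map] at h3
  apply mul_right_cancel₀ (hypMod_ne_zero (F := F) (α := α))
  rw [one_mul, mul_assoc, ← pow_succ, Nat.sub_add_cancel (Nat.one_le_pow _ _ hp.out.pos)]
  conv_rhs => rw [h3]
  rw [← Polynomial.polynomial_map_coe]
  rfl

variable (F) in
theorem hypLaurent_pow_eq (hα : ∀ i, 0 < α i ∧ α i < 1) (hα' : ∀ i, ¬ p ∣ (α i).den)
    (hl : classes (dworkIter p (dworkOrder p α ![1]) α) = classes α) :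
    ∃ c : RatFunc F, hypLaurent F α ^ (p ^ dworkOrder p α ![1] - 1) =
      algebraMap (RatFunc F) (LaurentSeries F) c := by
  refine ⟨(algebraMap F[X] (RatFunc F) ((polyA p α).map (algebraMap (ZMod p) F)))⁻¹, ?_⟩
  rw [map_inv₀, algebraMap_ratFunc_laurent]
  apply eq_inv_of_mul_eq_one_right
  rw [hypLaurent, ← map_pow, ← map_mul, mul_hypMod_pow_eq_one F hα hα' hl, map_one]

/-- With `f` the series, `(g * f^N)^M = 1`. The domain `F⟦X⟧` has no `M`-th roots of unity beyond
the constant powers of `ζ`, so `f^N = ζ^i / g`. -/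
theorem hypLaurent_pow_eq_of_polyA_eq_pow (hα : ∀ i, 0 < α i ∧ α i < 1)
    (hα' : ∀ i, ¬ p ∣ (α i).den)
    (hl : classes (dworkIter p (dworkOrder p α ![1]) α) = classes α)
    {M N : ℕ} (hM : 0 < M) (hMN : p ^ dworkOrder p α ![1] - 1 = N * M) {ζ : F}
    (hζ : IsPrimitiveRoot ζ M) {g : (ZMod p)[X]} (hg : polyA p α = g ^ M) :
    ∃ c : RatFunc F, hypLaurent F α ^ N = algebraMap (RatFunc F) (LaurentSeries F) c := by
  have h1 := mul_hypMod_pow_eq_one F hα hα' hl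
  rw [hMN, hg, Polynomial.map_pow, Polynomial.coe_pow, pow_mul, ← mul_pow] at h1
  have : NeZero M := ⟨hM.ne'⟩
  obtain ⟨i, -, hi⟩ := (hζ.map_of_injective (f := PowerSeries.C (R := F))
    (PowerSeries.C_injective)).eq_pow_of_pow_eq_one h1
  set G := g.map (algebraMap (ZMod p) F)
  have hG : (G : F⟦X⟧) ≠ 0 := by
    intro h0
    rw [h0, zero_mul, zero_pow hM.ne'] at h1
    exact zero_ne_one h1
  refine ⟨algebraMap F[X] (RatFunc F) (Polynomial.C (ζ ^ i)) /
    algebraMap F[X] (RatFunc F) G, ?_⟩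
  rw [map_div₀, algebraMap_ratFunc_laurent, algebraMap_ratFunc_laurent, eq_div_iff, hypLaurent,
    ← map_pow, ← map_mul, mul_comm, ← hi, Polynomial.coe_C,
    map_pow PowerSeries.C]
  exact (map_ne_zero_iff _ HahnSeries.ofPowerSeries_injective).2 hG

end Laurent

/-! ### Roots of unity in the residue field, and the theorem. -/

section Final

/-- A finite field of cardinality `q` contains primitive `n`-th roots of unity for `n ∣ q - 1`. -/
theorem exists_isPrimitiveRoot_of_dvd_card_sub_one {k : Type*} [Field k] [Finite k] {n : ℕ}
    (hn : n ∣ Nat.card k - 1) : ∃ ζ : k, IsPrimitiveRoot ζ n := by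
  classical
  obtain ⟨g, hg⟩ := IsCyclic.exists_ofOrder_eq_natCard (α := kˣ)
  rw [Nat.card_units] at hg
  have h0 : 0 < Nat.card k - 1 := Nat.sub_pos_of_lt Finite.one_lt_card
  obtain ⟨m, hm⟩ := hn
  have h1 : IsPrimitiveRoot (g : k) (Nat.card k - 1) :=
    IsPrimitiveRoot.coe_units_iff.2 (hg ▸ IsPrimitiveRoot.orderOf g)
  exact ⟨_, h1.pow h0 (by rw [hm, mul_comm])⟩

end Final

end GaussHyp

open GaussHyp in
theorem proposition3p3p3 (α : Fin 2 → ℚ) (hα : ∀ i, 0 < α i ∧ α i < 1)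
    (p : ℕ) [Fact p.Prime] (hp : p.Coprime (commonDenom α ![1]))
    (L : Type*) [Field L] [CharZero L] [IsCyclotomicExtension {commonDenom α ![1]} ℚ L]
    (l e m : ℕ) (hl : l = dworkOrder p α ![1]) (he : e = l / 2) (hm : m = (α 0 + α 1).den) :
    -- the coefficients of the series and of the series defining `B_k` reduce modulo `p`
    (∀ k n : ℕ, ¬ p ∣ (hypCoeff (dworkIter p k α) n).den) ∧
    -- factorization of `A(x)`, and `A(x)` is a perfect power
    (Even l → -(ZMod.unitOfCoprime p hp) ^ e ∈ groupD α ![1] →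
      (∃ v : ℤ, (v : ℚ) = (1 + (p : ℚ) ^ e) * (1 - α 0 - α 1) ∧
        algebraMap (ZMod p)[X] (RatFunc (ZMod p)) (polyA p α) =
          (1 - RatFunc.X) ^ v *
            algebraMap (ZMod p)[X] (RatFunc (ZMod p))
              (∏ k ∈ Finset.range e, polyB p α (e + k) ^ p ^ k) ^ (1 + p ^ e)) ∧
      m ∣ 1 + p ^ e ∧
      ∃ g : (ZMod p)[X], polyA p α = g ^ ((1 + p ^ e) / m)) ∧
    -- the Galois group over `k_𝔭(x)`, for each prime `𝔭` of `K` above `p`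
    (∀ (𝔭 : Ideal (𝓞 (fieldK α ![1] L))) [𝔭.IsPrime], (p : 𝓞 (fieldK α ![1] L)) ∈ 𝔭 →
      IsSeparable (RatFunc 𝔭.ResidueField) (hypLaurent 𝔭.ResidueField α) ∧
      (∃ φ : GalOf (RatFunc 𝔭.ResidueField) (hypLaurent 𝔭.ResidueField α) →*
          𝔭.ResidueFieldˣ, Function.Injective φ) ∧
      IsCyclic (GalOf (RatFunc 𝔭.ResidueField) (hypLaurent 𝔭.ResidueField α)) ∧
      (Even l → -(ZMod.unitOfCoprime p hp) ^ e ∈ groupD α ![1] →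
        Nat.card (GalOf (RatFunc 𝔭.ResidueField) (hypLaurent 𝔭.ResidueField α)) ∣ (p ^ e - 1) * m)) := by
  have hprime : p.Prime := Fact.out
  have hα' : ∀ i, ¬ p ∣ (α i).den := fun i =>
    not_dvd_den_of_dvd hp (den_dvd_commonDenom_left α ![1] i)
  have hcl : classes (dworkIter p (dworkOrder p α ![1]) α) = classes α :=
    classes_dworkIter_dworkOrder α ![1] hp
  obtain ⟨hl0, -⟩ := dworkOrder_spec α ![1] hp
  have hneg : -(ZMod.unitOfCoprime p hp) ^ e ∈ groupD α ![1] →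
      classes (dworkIter p e α) = classes fun i => 1 - α i := fun h =>
    classes_dworkIter_of_neg_mem hp (den_dvd_commonDenom_left α ![1]) e h.1
  have heven : Even l → dworkOrder p α ![1] = e + e := by
    rintro ⟨n, hn⟩
    omega
  refine ⟨fun k n => not_dvd_den_hypCoeff (fun i => not_dvd_den_dwork_iterate (hα' i) k) n, ?_, ?_⟩
  · intro h1 h2
    subst hm
    exact ⟨polyA_eq_of_classes_eq hα hα' (hneg h2) (heven h1),
      exists_pow_eq_polyA hα hα' (hneg h2) (heven h1)⟩
  · intro 𝔭 _ hp𝔭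
    obtain ⟨hfin, f, hf, hfD⟩ := exists_card_quotient_eq_pow α ![1] hp L 𝔭 hp𝔭
    have hmax : 𝔭.IsMaximal := Ideal.Quotient.maximal_of_isField _
      (Finite.isField_of_domain (𝓞 (fieldK α ![1] L) ⧸ 𝔭))
    have hbij := 𝔭.bijective_algebraMap_quotient_residueField
    have hfink : Finite 𝔭.ResidueField := Finite.of_surjective _ hbij.2
    have hcard : Nat.card 𝔭.ResidueField = p ^ f := by
      rw [← hf, Nat.card_congr (Equiv.ofBijective _ hbij)]
    have hpk : (p : 𝔭.ResidueField) = 0 := by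
      rw [← map_natCast (algebraMap (𝓞 (fieldK α ![1] L)) 𝔭.ResidueField)]
      exact Ideal.algebraMap_residueField_eq_zero.2 hp𝔭
    have hchar : CharP 𝔭.ResidueField p := (CharP.charP_iff_prime_eq_zero hprime).2 hpk
    let _ : Algebra (ZMod p) 𝔭.ResidueField := ZMod.algebra _ p
    -- `ℓ_p` divides `f` since `p^f ∈ D`.
    have hdvd : p ^ dworkOrder p α ![1] - 1 ∣ Nat.card 𝔭.ResidueField - 1 := by
      rw [hcard]
      exact Nat.pow_sub_one_dvd_pow_sub_one _ (dworkOrder_dvd α ![1] hp hfD)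
    have hNpos : 0 < p ^ dworkOrder p α ![1] - 1 :=
      Nat.sub_pos_of_lt (Nat.one_lt_pow hl0.ne' hprime.one_lt)
    have hNF : ((p ^ dworkOrder p α ![1] - 1 : ℕ) : RatFunc 𝔭.ResidueField) ≠ 0 := by
      rw [← map_natCast (algebraMap 𝔭.ResidueField (RatFunc 𝔭.ResidueField)), Ne, map_eq_zero,
        Nat.cast_sub (Nat.one_le_pow _ _ hprime.pos), Nat.cast_pow, hpk, zero_pow hl0.ne']
      simp
    obtain ⟨ζ, hζ⟩ := exists_isPrimitiveRoot_of_dvd_card_sub_one hdvd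
    obtain ⟨c, hc⟩ := hypLaurent_pow_eq 𝔭.ResidueField hα hα' hcl
    have hne : hypLaurent 𝔭.ResidueField α ≠ 0 := hypLaurent_ne_zero
    obtain ⟨φ, hφ, -⟩ := exists_kummer_character hNpos hζ hne hc
    refine ⟨isSeparable_of_pow_eq hNF hne hc, ⟨φ, hφ⟩, ?_, ?_⟩
    · exact isCyclic_of_injective φ hφ
    · intro h1 h2
      obtain ⟨⟨M, hM⟩, g, hg⟩ := exists_pow_eq_polyA hα hα' (hneg h2) (heven h1)
      rw [hM, Nat.mul_div_cancel_left _ (α 0 + α 1).den_pos] at hg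
      rw [← hm] at hM
      have hM0 : 0 < M := Nat.pos_of_ne_zero (by rintro rfl; simp at hM)
      -- `p^(2e) - 1 = (p^e - 1) * (p^e + 1)` with `p^e + 1 = m * M`. Powers of `ζ` then supply
      -- primitive roots of order `M` and `(p^e - 1) * m`.
      have hMN : p ^ dworkOrder p α ![1] - 1 = (p ^ e - 1) * m * M := by
        rw [mul_assoc, ← hM, heven h1, pow_add, mul_comm (p ^ e - 1), Nat.add_comm 1,
          ← Nat.mul_self_sub_mul_self_eq]
      have hζM := hζ.pow hNpos hMN
      have hζN := hζ.pow hNpos (hMN.trans (mul_comm _ _))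
      obtain ⟨c', hc'⟩ := hypLaurent_pow_eq_of_polyA_eq_pow hα hα' hcl hM0 hMN hζM hg
      refine card_gal_dvd_of_pow_eq ?_ hζN hne hc'
      rw [hMN] at hNpos
      exact Nat.pos_of_mul_pos_right hNpos
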